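/- Define the generalized Hermite polynomials $H_{m,n}(y)$, $m,n\in\mathbb{N}_0$, by $H_{0,0}=H_{1,0}=H_{0,1}=1$, $H_{1,1}=2y$ and the recurrence relations $$2mH_{m+1,n}H_{m-1,n}=H_{m,n}H_{m,n}''-(H_{m,n}')^2+2mH_{m,n}^2,\qquad 2nH_{m,n+1}H_{m,n-1}=-H_{m,n}H_{m,n}''+(H_{m,n}')^2+2nH_{m,n}^2,$$ and set $w^{(I)}_{m,n}(y)=\frac{d}{dy}\log\frac{H_{m+1,n}(y)}{H_{m,n}(y)}$, a rational function (a rational solution of the Painlevé-IV equation). Let $m\ge n\ge 1$ be integers, $r=m/n$, $x\in\mathbb{C}$, and let $C$ be the unit circle oriented clockwise, so that the left ($+$) side of $C$ is its exterior and the right ($-$) side its interior. Let $\mathbf{N}(z)=\mathbf{N}_{m,n}(z;x)$ be a $2\times2$ matrix-valued function that is analytic in $\mathbb{C}\setminus C$, has Hölder-continuous boundary values $\mathbf{N}_\pm$ on $C$ with $$\mathbf{N}_+(z)=\mathbf{N}_-(z)\begin{bmatrix}1&\frac{1}{2\pi i}e^{-n\theta(z;x,r)}\\0&1\end{bmatrix},\quad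 z\in C,\qquad \theta(z;x,r)=(1-r)\log z-\frac{2r^{1/2}x}{z}+\frac1{z^2},$$ and satisfies $\mathbf{N}(z)=(\mathbb{I}+\mathcal{O}(z^{-1}))z^{n\sigma_3}$ as $z\to\infty$, uniformly with respect to direction, where $\sigma_3=\mathrm{diag}(1,-1)$. Write $\mathbf{N}(z)=\mathbf{N}_0+\mathbf{N}_1z+\mathcal{O}(z^2)$ as $z\to0$, and assume $[\mathbf{N}_0]_{11}\neq0$. Then $H_{m,n}(m^{1/2}x)\ne0$ and $H_{m+1,n}(m^{1/2}x)\neq0$, so that $w^{(I)}_{m,n}$ is analytic at $m^{1/2}x$, and $$\frac{1}{n^{1/2}}w^{(I)}_{m,n}(m^{1/2}x)=\big([\mathbf{N}_0]_{11}[\mathbf{N}_0]_{22}+[\mathbf{N}_0]_{12}[\mathbf{N}_0]_{21}-1\big)\frac{[\mathbf{N}_1]_{11}}{[\mathbf{N}_0]_{11}}-2[\mathbf{N}_0]_{12}[\mathbf{N}_1]_{21}.$$ -/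

import Mathlib

open Filter Topology Asymptotics Polynomial Bornology

noncomputable section

namespace PainleveIV

/-- The generalized Hermite polynomials `H_{m,n}`, given by the initial values
`H_{0,0} = H_{1,0} = H_{0,1} = 1`, `H_{1,1} = 2y` and the recurrence relations
`2m H_{m+1,n} H_{m-1,n} = H_{m,n} H_{m,n}'' - (H_{m,n}')^2 + 2m H_{m,n}^2`,
`2n H_{m,n+1} H_{m,n-1} = -H_{m,n} H_{m,n}'' + (H_{m,n}')^2 + 2n H_{m,n}^2`.
The rows `m = 0` and `m = 1` are filled in with the second relation, and then every column with
the first one. All the quotients are exact quotients of polynomials. -/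
def genHermite : ℕ → ℕ → ℂ[X]
  | 0, 0 => 1
  | 0, 1 => 1
  | 0, n + 2 =>
      (-(genHermite 0 (n + 1) * derivative (derivative (genHermite 0 (n + 1))))
          + derivative (genHermite 0 (n + 1)) ^ 2
          + C (2 * ((n : ℂ) + 1)) * genHermite 0 (n + 1) ^ 2)
        / (C (2 * ((n : ℂ) + 1)) * genHermite 0 n)
  | 1, 0 => 1
  | 1, 1 => C 2 * X
  | 1, n + 2 =>
      (-(genHermite 1 (n + 1) * derivative (derivative (genHermite 1 (n + 1))))
          + derivative (genHermite 1 (n + 1)) ^ 2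
          + C (2 * ((n : ℂ) + 1)) * genHermite 1 (n + 1) ^ 2)
        / (C (2 * ((n : ℂ) + 1)) * genHermite 1 n)
  | m + 2, n =>
      (genHermite (m + 1) n * derivative (derivative (genHermite (m + 1) n))
          - derivative (genHermite (m + 1) n) ^ 2
          + C (2 * ((m : ℂ) + 1)) * genHermite (m + 1) n ^ 2)
        / (C (2 * ((m : ℂ) + 1)) * genHermite m n)

/-- The rational Painlevé-IV function of the first type,
`w_{m,n}^{(I)}(y) = d/dy log (H_{m+1,n}(y) / H_{m,n}(y))`. -/
def wI (m n : ℕ) (y : ℂ) : ℂ :=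
  logDeriv (fun u : ℂ => (genHermite (m + 1) n).eval u / (genHermite m n).eval u) y

/-- `θ(z; x, r) = (1 - r) log z - 2 r^{1/2} x / z + 1 / z^2`. -/
def theta (z x : ℂ) (r : ℝ) : ℂ :=
  (1 - (r : ℂ)) * Complex.log z - 2 * ((Real.sqrt r : ℝ) : ℂ) * x / z + 1 / z ^ 2

/-- The jump matrix on the unit circle, where `r = m / n`. -/
def jump (m n : ℕ) (x z : ℂ) : Matrix (Fin 2) (Fin 2) ℂ :=
  !![1, 1 / (2 * (Real.pi : ℂ) * Complex.I)
        * Complex.exp (-(n : ℂ) * theta z x ((m : ℝ) / (n : ℝ)));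
     0, 1]

/-- `N` solves the scaled orthogonal-polynomial Riemann-Hilbert problem with parameters `m, n, x`.
The contour is the unit circle oriented clockwise, so that its left (`+`) side is the exterior
and its right (`-`) side is the interior. The values of `N` on the circle itself play no role. -/
structure IsSolution (m n : ℕ) (x : ℂ) (N : ℂ → Matrix (Fin 2) (Fin 2) ℂ) : Prop where
  /-- `N` is analytic off the unit circle. -/
  analytic : ∀ i j, AnalyticOnNhd ℂ (fun z => N z i j) (Metric.sphere (0 : ℂ) 1)ᶜ
  /-- `N` has Hölder-continuous boundary values, related by the jump condition. -/
  boundary : ∃ Nplus Nminus : ℂ → Matrix (Fin 2) (Fin 2) ℂ,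
    (∃ K α : NNReal, 0 < α ∧ α ≤ 1 ∧ ∀ i j,
      HolderOnWith K α (fun z => Nplus z i j) (Metric.sphere (0 : ℂ) 1) ∧
      HolderOnWith K α (fun z => Nminus z i j) (Metric.sphere (0 : ℂ) 1)) ∧
    (∀ s ∈ Metric.sphere (0 : ℂ) 1, ∀ i j,
      Tendsto (fun z => N z i j) (𝓝[(Metric.closedBall (0 : ℂ) 1)ᶜ] s) (𝓝 (Nplus s i j)) ∧
      Tendsto (fun z => N z i j) (𝓝[Metric.ball (0 : ℂ) 1] s) (𝓝 (Nminus s i j))) ∧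
    (∀ s ∈ Metric.sphere (0 : ℂ) 1, Nplus s = Nminus s * jump m n x s)
  /-- `N(z) = (I + O(1/z)) z^{n σ₃}` as `z → ∞`, uniformly with respect to direction. -/
  normalization : ∀ i j,
    (fun z : ℂ => (N z * !![(z ^ n)⁻¹, 0; 0, z ^ n] - 1) i j) =O[cobounded ℂ]
      (fun z : ℂ => z⁻¹)

end PainleveIV

end

/-! ### Determinant identities of Jacobi and Desnanot type -/

namespace Matrix

variable {R : Type*} [CommRing R]

/-! The jump is upper triangular, so the first column of `N` continues across the circle. By its
growth it consists inside of polynomials: `p`, monic of degree `n`, and `q`, of smaller degree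
(`IsSolution.exists_polynomial`). The jump of the second column turns its behaviour at infinity and
its value at `0` into moments: `p` is orthogonal to all degrees below `n`, `q` to all degrees below
`n - 1`. After the scaling `ρ = √n`, `y = √m x` the weight is `s ^ (m - n) * exp (2ρy/s - ρ²/s²)`, a
power times the Hermite generating function in `ρ/s`, so the moments are Hermite polynomials in `y`
(`weightFunctional_X_pow`).

On the algebraic side, `H_{m,n}` is a nonzero constant times a Hankel determinant of the `H_k / k!`
(`genHermite_eq_hankel`). Uniqueness of the orthogonal polynomial makes the determinant for
`H_{m,n}` nonzero, and Cramer's rule gives `H_{m+1,n} / H_{m,n} = const * p(0)`. Thus both values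
are nonzero when `p(0) = [N₀]₁₁ ≠ 0`, and `w` is the logarithmic `y`-derivative of `p(0)`.

Differentiation in `y` multiplies the weight by `2ρ/s`. Differentiating the linear system for `p`
therefore leaves a right-hand side with a single nonzero entry, proportional to `[N₀]₁₂`. The
polynomial `(p(0) q - q(0) p) / z` solves that system up to a scalar, so the derivative of `p(0)` is
expressed through coefficients of `p` and `q` (`hankel_deformation`). The relation `det N₀ = 1`
gives the stated form. -/

lemma det_one_updateCol_updateCol {n : Type*} [Fintype n] [DecidableEq n] {i j : n} (hij : i ≠ j)
    (u v : n → R) :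
    (((1 : Matrix n n R).updateCol i u).updateCol j v).det = u i * v j - v i * u j := by
  let A : Matrix n (Fin 2) R := Matrix.of fun k l =>
    if l = 0 then u k - (1 : Matrix n n R) k i else v k - (1 : Matrix n n R) k j
  let B : Matrix (Fin 2) n R := Matrix.of fun l k =>
    if l = 0 then (1 : Matrix n n R) i k else (1 : Matrix n n R) j k
  -- A perturbation of the identity of rank at most two: `det (1 + A B) = det (1 + B A)` reduces it
  -- to a two-by-two determinant.
  have h : ((1 : Matrix n n R).updateCol i u).updateCol j v = 1 + A * B := by
    ext k l
    simp only [Matrix.add_apply, Matrix.mul_apply, Fin.sum_univ_two, A, B, Matrix.of_apply,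
      Matrix.updateCol_apply]
    by_cases h1 : l = j
    · subst h1
      simp [Matrix.one_apply, hij]
    · by_cases h2 : l = i
      · subst h2
        simp [Matrix.one_apply, h1, Ne.symm h1]
      · simp [Matrix.one_apply, h1, h2, Ne.symm h1, Ne.symm h2]
  rw [h, Matrix.det_one_add_mul_comm, Matrix.det_fin_two]
  simp [A, B, Matrix.mul_apply, Matrix.one_apply, mul_sub, Finset.sum_sub_distrib, hij,
    hij.symm]

/-- Multiplying `M` by the identity with two columns taken from the adjugate produces `det M` times
unit vectors in those columns. Taking determinants gives the identity times one extra factor `det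
M`, which is cancelled. -/
lemma det_mul_det_updateCol_updateCol_of_regular {n : Type*} [Fintype n] [DecidableEq n]
    [IsDomain R] {i j : n}
    (hij : i ≠ j) (M : Matrix n n R) (hM : M.det ≠ 0) :
    M.det * ((M.updateCol i (Pi.single i 1)).updateCol j (Pi.single j 1)).det
      = M.adjugate i i * M.adjugate j j - M.adjugate i j * M.adjugate j i := by
  have h := det_one_updateCol_updateCol hij (fun k => M.adjugate k i) (fun k => M.adjugate k j)
  rw [← h]
  have key : M * (((1 : Matrix n n R).updateCol i (fun k => M.adjugate k i)).updateCol j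
      (fun k => M.adjugate k j))
      = (M.updateCol i (M.det • Pi.single i 1)).updateCol j (M.det • Pi.single j 1) := by
    have hadj := fun k l => congrFun (congrFun (Matrix.mul_adjugate M) k) l
    ext k l
    by_cases h1 : l = j
    · subst h1
      have := hadj k l
      simp only [Matrix.mul_apply, Matrix.smul_apply, Matrix.one_apply] at this
      simp [Matrix.mul_apply, this, Pi.single_apply]
    · by_cases h2 : l = i
      · subst h2
        have := hadj k l
        simp only [Matrix.mul_apply, Matrix.smul_apply, Matrix.one_apply] at this
        simp [Matrix.mul_apply, this, Pi.single_apply, h1]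
      · simp [Matrix.mul_apply, h1, h2, Matrix.one_apply]
  have hd := congrArg Matrix.det key
  rw [Matrix.det_mul, Matrix.det_updateCol_smul, Matrix.updateCol_comm M hij,
    Matrix.det_updateCol_smul, Matrix.updateCol_comm M hij.symm] at hd
  exact (mul_left_cancel₀ hM hd).symm

/-- Jacobi's identity for the two-by-two minors of the adjugate. -/
theorem det_mul_det_updateCol_updateCol {n : Type*} [Fintype n] [DecidableEq n] {i j : n}
    (hij : i ≠ j) (M : Matrix n n R) :
    M.det * ((M.updateCol i (Pi.single i 1)).updateCol j (Pi.single j 1)).det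
      = M.adjugate i i * M.adjugate j j - M.adjugate i j * M.adjugate j i := by
  -- The generic matrix over `ℤ` has nonzero determinant; the identity then specializes to any
  -- commutative ring.
  have h := det_mul_det_updateCol_updateCol_of_regular hij (Matrix.mvPolynomialX n n ℤ)
    (Matrix.det_mvPolynomialX_ne_zero n ℤ)
  have h' := congrArg (MvPolynomial.aeval (R := ℤ) fun p : n × n => M p.1 p.2) h
  have hX : (Matrix.mvPolynomialX n n ℤ).map
      (MvPolynomial.aeval (R := ℤ) fun p : n × n => M p.1 p.2) = M :=
    Matrix.mvPolynomialX_mapMatrix_aeval ℤ M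
  have hA : ∀ k l, MvPolynomial.aeval (R := ℤ) (fun p : n × n => M p.1 p.2)
      ((Matrix.mvPolynomialX n n ℤ).adjugate k l) = M.adjugate k l := by
    intro k l
    have := AlgHom.map_adjugate (MvPolynomial.aeval (R := ℤ) fun p : n × n => M p.1 p.2)
      (Matrix.mvPolynomialX n n ℤ)
    rw [Matrix.mvPolynomialX_mapMatrix_aeval ℤ M] at this
    rw [← this]; rfl
  have hs : ∀ k : n, (MvPolynomial.aeval (R := ℤ) fun p : n × n => M p.1 p.2) ∘
      (Pi.single k 1 : n → MvPolynomial (n × n) ℤ) = Pi.single k 1 := by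
    intro k; ext l; by_cases h : l = k <;> simp [h]
  simp only [map_mul, map_sub, hA] at h'
  rw [AlgHom.map_det, AlgHom.map_det] at h'
  simp only [AlgHom.mapMatrix_apply, Matrix.map_updateCol, hX, hs] at h'
  exact h'

lemma det_updateCol_single_self {n : ℕ} (M : Matrix (Fin (n + 1)) (Fin (n + 1)) R)
    (i : Fin (n + 1)) :
    (M.updateCol i (Pi.single i 1)).det = (M.submatrix i.succAbove i.succAbove).det := by
  have h := Matrix.adjugate_fin_succ_eq_det_submatrix Mᵀ i i
  rw [Matrix.adjugate_apply, Matrix.updateRow_transpose, Matrix.det_transpose,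
    ← Matrix.transpose_submatrix, Matrix.det_transpose, ← two_mul, pow_mul] at h
  simpa using h

lemma det_updateCol_castSucc_updateCol_last {n : ℕ} (M : Matrix (Fin (n + 2)) (Fin (n + 2)) R)
    (i : Fin (n + 1)) :
    ((M.updateCol i.castSucc (Pi.single i.castSucc 1)).updateCol (Fin.last (n + 1))
      (Pi.single (Fin.last (n + 1)) 1)).det
      = (M.submatrix (fun k => (i.succAbove k).castSucc) fun k => (i.succAbove k).castSucc).det := by
  rw [det_updateCol_single_self, Fin.succAbove_last]
  have h : (M.updateCol i.castSucc (Pi.single i.castSucc 1)).submatrix Fin.castSucc Fin.castSucc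
      = (M.submatrix Fin.castSucc Fin.castSucc).updateCol i (Pi.single i 1) := by
    ext k l
    by_cases hl : l = i
    · subst hl
      simp [Pi.single_apply]
    · simp [hl]
  rw [h, det_updateCol_single_self, Matrix.submatrix_submatrix]
  rfl

/-- The Desnanot-Jacobi identity. -/
theorem det_mul_det_interior {n : ℕ} (M : Matrix (Fin (n + 2)) (Fin (n + 2)) R) :
    M.det * (M.submatrix (fun k : Fin n => k.succ.castSucc) fun k => k.succ.castSucc).det
      = (M.submatrix Fin.succ Fin.succ).det * (M.submatrix Fin.castSucc Fin.castSucc).det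
        - (M.submatrix Fin.castSucc Fin.succ).det * (M.submatrix Fin.succ Fin.castSucc).det := by
  have h := det_mul_det_updateCol_updateCol (i := (0 : Fin (n + 1)).castSucc)
    (j := Fin.last (n + 1)) (by simp [Fin.ext_iff]) M
  rw [det_updateCol_castSucc_updateCol_last] at h
  simp only [Matrix.adjugate_fin_succ_eq_det_submatrix, Fin.succAbove_last, Fin.castSucc_zero,
    Fin.succAbove_zero] at h
  rw [h]
  have h1 : ((-1 : R) ^ (n + 1)) * (-1) ^ (n + 1) = 1 := by
    rw [← mul_pow]; simp
  have h2 : ((-1 : R) ^ (n + 1 + (n + 1))) = 1 := by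
    rw [pow_add, h1]
  simp only [Fin.val_zero, Fin.val_last, add_zero, zero_add, pow_zero, h2, one_mul]
  linear_combination -(M.submatrix Fin.castSucc Fin.succ).det
    * (M.submatrix Fin.succ Fin.castSucc).det * h1

/-- Jacobi's identity for the minors in the last two rows and columns. -/
theorem det_mul_det_leading {n : ℕ} (M : Matrix (Fin (n + 2)) (Fin (n + 2)) R) :
    M.det * (M.submatrix (fun k : Fin n => k.castSucc.castSucc) fun k => k.castSucc.castSucc).det
      = (M.submatrix (Fin.last n).castSucc.succAbove (Fin.last n).castSucc.succAbove).det
          * (M.submatrix Fin.castSucc Fin.castSucc).det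
        - (M.submatrix (Fin.last n).castSucc.succAbove Fin.castSucc).det
          * (M.submatrix Fin.castSucc (Fin.last n).castSucc.succAbove).det := by
  have h := det_mul_det_updateCol_updateCol (i := (Fin.last n).castSucc)
    (j := Fin.last (n + 1)) (by simp [Fin.ext_iff]) M
  rw [det_updateCol_castSucc_updateCol_last] at h
  simp only [Matrix.adjugate_fin_succ_eq_det_submatrix, Fin.succAbove_last] at h
  rw [h]
  have h1 : ((-1 : R) ^ (n + 1 + n)) * (-1) ^ (n + (n + 1)) = 1 := by
    rw [add_comm n (n + 1), ← mul_pow]; simp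
  have h2 : ((-1 : R) ^ (n + 1 + (n + 1))) = 1 := by
    rw [pow_add, ← mul_pow]; simp
  have h3 : ((-1 : R) ^ (n + n)) = 1 := by
    rw [pow_add, ← mul_pow]; simp
  simp only [Fin.val_last, Fin.val_castSucc, h2, h3, one_mul]
  linear_combination -(M.submatrix Fin.castSucc (Fin.last n).castSucc.succAbove).det
    * (M.submatrix (Fin.last n).castSucc.succAbove Fin.castSucc).det * h1

end Matrix

/-! ### Hermite polynomials and the Toda equation for their Hankel determinants -/

lemma Polynomial.derivative_det {R n : Type*} [CommRing R] [Fintype n] [DecidableEq n]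
    (M : Matrix n n R[X]) :
    derivative M.det = ∑ j, (M.updateCol j fun i => derivative (M i j)).det := by
  simp only [Matrix.det_apply, derivative_sum, derivative_smul, derivative_prod_finset,
    Finset.smul_sum, Units.smul_def]
  rw [Finset.sum_comm]
  refine Finset.sum_congr rfl fun j _ => Finset.sum_congr rfl fun σ _ => ?_
  have h : ∏ i ∈ Finset.univ.erase j, M.updateCol j (fun i => derivative (M i j)) (σ i) i
      = ∏ i ∈ Finset.univ.erase j, M (σ i) i :=
    Finset.prod_congr rfl fun i hi => by simp [Finset.ne_of_mem_erase hi]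
  rw [← Finset.prod_erase_mul _ _ (Finset.mem_univ j), h, Matrix.updateCol_self]

noncomputable section

namespace PainleveIV

/-- The Hermite polynomials in the normalization with leading coefficient `2 ^ k`. -/
def hermitePoly : ℕ → ℂ[X]
  | 0 => 1
  | k + 1 => C 2 * X * hermitePoly k - derivative (hermitePoly k)

lemma derivative_hermitePoly (k : ℕ) :
    derivative (hermitePoly k) = C 2 * X * hermitePoly k - hermitePoly (k + 1) := by
  simp [hermitePoly]

lemma derivative_hermitePoly_succ (k : ℕ) :
    derivative (hermitePoly (k + 1)) = C (2 * ((k : ℂ) + 1)) * hermitePoly k := by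
  induction k with
  | zero => simp [hermitePoly]
  | succ k ih =>
    rw [hermitePoly, derivative_sub, ih, derivative_C_mul, derivative_mul, ih, derivative_C_mul,
      derivative_X, derivative_hermitePoly]
    simp only [map_mul, map_add, map_one, map_natCast, Nat.cast_add, Nat.cast_one]
    ring

lemma hermitePoly_ne_zero (k : ℕ) : hermitePoly k ≠ 0 := by
  induction k with
  | zero => simp [hermitePoly]
  | succ k ih =>
    intro h
    have := derivative_hermitePoly_succ k
    rw [h, derivative_zero] at this
    have h2 : (2 * ((k : ℂ) + 1)) ≠ 0 := mul_ne_zero two_ne_zero (Nat.cast_add_one_ne_zero k)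
    exact (mul_ne_zero (C_ne_zero.2 h2) ih) this.symm

/-- Since `H_k' = 2X H_k - H_{k+1}`, differentiating a column shifts it onto its right neighbour, so
only the shift of the last column survives. The row indices `e` are free so that the result can be
differentiated again. -/
lemma derivative_det_hermitePoly {n : ℕ} (e : Fin (n + 1) → ℕ) :
    derivative (Matrix.of fun i j : Fin (n + 1) => hermitePoly (e i + j)).det
      = C (2 * ((n : ℂ) + 1)) * X * (Matrix.of fun i j : Fin (n + 1) => hermitePoly (e i + j)).det
        - (Matrix.of fun i j : Fin (n + 1) =>
            hermitePoly (e i + (Fin.last n).castSucc.succAbove j)).det := by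
  set M : Matrix (Fin (n + 1)) (Fin (n + 1)) ℂ[X] := Matrix.of fun i j => hermitePoly (e i + j)
    with hM
  have h1 : ∀ j, (M.updateCol j fun i => derivative (M i j)).det
      = C 2 * X * M.det - (M.updateCol j fun i => hermitePoly (e i + j + 1)).det := by
    intro j
    have h : (fun i => derivative (M i j))
        = (C 2 * X : ℂ[X]) • (fun i => M i j) + (-1 : ℂ[X]) • fun i => hermitePoly (e i + j + 1) := by
      ext1 i
      simp [hM, derivative_hermitePoly, sub_eq_add_neg]
    rw [h, Matrix.det_updateCol_add, Matrix.det_updateCol_smul, Matrix.det_updateCol_smul,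
      Matrix.updateCol_eq_self]
    ring
  have h2 : ∀ j : Fin n, (M.updateCol j.castSucc
      fun i => hermitePoly (e i + j.castSucc + 1)).det = 0 := by
    intro j
    refine Matrix.det_zero_of_column_eq (i := j.castSucc) (j := j.succ)
      (by simp [Fin.ext_iff]) fun i => ?_
    rw [Matrix.updateCol_self, Matrix.updateCol_ne (by simp [Fin.ext_iff])]
    simp [hM, add_assoc]
  have h3 : M.updateCol (Fin.last n) (fun i => hermitePoly (e i + Fin.last n + 1))
      = Matrix.of fun i j : Fin (n + 1) =>
          hermitePoly (e i + (Fin.last n).castSucc.succAbove j) := by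
    ext1 i j
    refine Fin.lastCases ?_ (fun j => ?_) j
    · simp [add_assoc]
    · rw [Matrix.updateCol_ne (by simp [Fin.ext_iff, j.2.ne])]
      simp [hM, Fin.succAbove_of_castSucc_lt, Fin.lt_def]
  rw [Polynomial.derivative_det, Finset.sum_congr rfl fun j _ => h1 j, Finset.sum_sub_distrib,
    Fin.sum_univ_castSucc (fun j => (M.updateCol j fun i => hermitePoly (e i + j + 1)).det),
    Finset.sum_eq_zero fun j _ => h2 j, h3]
  simp
  ring

/-- The Hankel determinant of Hermite polynomials. -/
def hankelDet (m n : ℕ) : ℂ[X] :=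
  (Matrix.of fun i j : Fin n => hermitePoly (m + i + j)).det

@[simp] lemma hankelDet_zero (m : ℕ) : hankelDet m 0 = 1 := by simp [hankelDet]

@[simp] lemma hankelDet_one (m : ℕ) : hankelDet m 1 = hermitePoly m := by simp [hankelDet]

/-- The Toda equation for the Hankel determinants of Hermite polynomials. -/
lemma hankelDet_toda (m n : ℕ) :
    hankelDet m (n + 2) * hankelDet m n
      = hankelDet m (n + 1) * derivative (derivative (hankelDet m (n + 1)))
        - derivative (hankelDet m (n + 1)) ^ 2
        - C (2 * ((n : ℂ) + 1)) * hankelDet m (n + 1) ^ 2 := by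
  have hj := Matrix.det_mul_det_leading
    (Matrix.of fun i j : Fin (n + 2) => hermitePoly (m + i + j))
  have d1 := derivative_det_hermitePoly fun i : Fin (n + 1) => m + i
  have d2 := derivative_det_hermitePoly
    fun i : Fin (n + 1) => m + ((Fin.last n).castSucc.succAbove i : ℕ)
  -- By symmetry of the Hankel matrix the two mixed minors agree, and both come from the first
  -- derivative.
  have ht : (Matrix.of fun i j : Fin (n + 1) =>
      hermitePoly (m + i + (Fin.last n).castSucc.succAbove j)).det
      = (Matrix.of fun i j : Fin (n + 1) =>
        hermitePoly (m + (Fin.last n).castSucc.succAbove i + j)).det := by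
    rw [← Matrix.det_transpose]
    congr 1
    ext1 i j
    simp [add_right_comm]
  simp only [Matrix.submatrix, Matrix.of_apply, Fin.val_castSucc] at hj
  rw [ht] at d1 hj
  simp only [hankelDet]
  rw [hj, d1, derivative_sub, derivative_mul, derivative_C_mul, derivative_X, d1, d2]
  ring

/-- Differentiation lowers degrees, so `c p²` dominates. This keeps the Toda recursion from reaching
zero. -/
lemma mul_derivative_derivative_sub_add_ne_zero (p : ℂ[X]) (c : ℂ) (hc : c ≠ 0) (hp : p ≠ 0) :
    p * derivative (derivative p) - derivative p ^ 2 + C c * p ^ 2 ≠ 0 := by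
  intro h
  by_cases h0 : derivative p = 0
  · simp [h0, hp, hc] at h
  have hd : (derivative p).degree < p.degree := degree_derivative_lt hp
  have hdd : (derivative (derivative p)).degree < p.degree :=
    (degree_derivative_lt h0).trans hd
  have e1 : (p * derivative (derivative p)).degree < (p ^ 2).degree := by
    rw [pow_two, degree_mul, degree_mul]
    exact WithBot.add_lt_add_left (by simpa using hp) hdd
  have e2 : (derivative p ^ 2).degree < (p ^ 2).degree := by
    rw [pow_two, pow_two, degree_mul, degree_mul]
    exact WithBot.add_lt_add_of_lt_of_le (by simpa using h0) hd hd.le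
  have e3 : (C c * p ^ 2).degree = (p ^ 2).degree := degree_C_mul hc
  have e4 : (p * derivative (derivative p) - derivative p ^ 2).degree < (C c * p ^ 2).degree :=
    e3 ▸ (degree_sub_le _ _).trans_lt (max_lt e1 e2)
  have := degree_add_eq_right_of_degree_lt e4
  rw [h, e3] at this
  exact pow_ne_zero 2 hp (degree_eq_bot.1 (by simpa using this.symm))

lemma hankelDet_ne_zero (m n : ℕ) : hankelDet m n ≠ 0 := by
  induction n using Nat.strong_induction_on with
  | _ n ih =>
    match n with
    | 0 => simp
    | 1 => simpa using hermitePoly_ne_zero m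
    | n + 2 =>
      intro h
      have ht := hankelDet_toda m n
      rw [h, zero_mul] at ht
      refine mul_derivative_derivative_sub_add_ne_zero (hankelDet m (n + 1))
        (-(2 * ((n : ℂ) + 1))) ?_ (ih _ (by omega)) ?_
      · exact neg_ne_zero.2 (mul_ne_zero two_ne_zero (Nat.cast_add_one_ne_zero n))
      · rw [ht, map_neg]; ring


/-! ### Wronskian form and the relation in the first index -/

/-- `H_k / k!`, the coefficients of the generating function `exp (2 y t - t ^ 2)`. -/
def hermiteCoeff (k : ℕ) : ℂ[X] := C (k.factorial : ℂ)⁻¹ * hermitePoly k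

lemma C_factorial_mul_hermiteCoeff (k : ℕ) :
    C (k.factorial : ℂ) * hermiteCoeff k = hermitePoly k := by
  rw [hermiteCoeff, ← mul_assoc, ← C_mul, mul_inv_cancel₀ (by exact_mod_cast k.factorial_ne_zero)]
  simp

lemma derivative_hermiteCoeff_succ (k : ℕ) :
    derivative (hermiteCoeff (k + 1)) = C 2 * hermiteCoeff k := by
  rw [hermiteCoeff, derivative_C_mul, derivative_hermitePoly_succ, hermiteCoeff, ← mul_assoc,
    ← mul_assoc, ← C_mul, ← C_mul]
  congr 2
  have : ((k : ℂ) + 1) ≠ 0 := Nat.cast_add_one_ne_zero k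
  rw [Nat.factorial_succ]
  push_cast
  field_simp

lemma iterate_derivative_succ_hermiteCoeff_succ (i k : ℕ) :
    derivative^[i + 1] (hermiteCoeff (k + 1)) = C 2 * derivative^[i] (hermiteCoeff k) := by
  rw [Function.iterate_succ_apply, derivative_hermiteCoeff_succ, iterate_derivative_C_mul]

lemma iterate_derivative_hermiteCoeff_add (i k : ℕ) :
    derivative^[i] (hermiteCoeff (k + i)) = C (2 ^ i) * hermiteCoeff k := by
  induction i with
  | zero => simp
  | succ i ih =>
    rw [← add_assoc, iterate_derivative_succ_hermiteCoeff_succ, ih, ← mul_assoc, ← C_mul, pow_succ']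

/-- The coefficients of `(2 X - d/dX) ^ i` as a differential operator. -/
def raisingCoeff : ℕ → ℕ → ℂ[X]
  | 0, 0 => 1
  | 0, _ + 1 => 0
  | i + 1, 0 => C 2 * X * raisingCoeff i 0 - derivative (raisingCoeff i 0)
  | i + 1, l + 1 =>
      C 2 * X * raisingCoeff i (l + 1) - derivative (raisingCoeff i (l + 1)) - raisingCoeff i l

lemma raisingCoeff_of_lt {i l : ℕ} (h : i < l) : raisingCoeff i l = 0 := by
  induction i generalizing l with
  | zero =>
    obtain ⟨l, rfl⟩ := Nat.exists_eq_succ_of_ne_zero h.ne'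
    rfl
  | succ i ih =>
    obtain ⟨l, rfl⟩ := Nat.exists_eq_succ_of_ne_zero (Nat.ne_zero_of_lt h)
    simp [raisingCoeff, ih (show i < l by omega), ih (show i < l + 1 by omega)]

lemma raisingCoeff_self (i : ℕ) : raisingCoeff i i = C ((-1) ^ i) := by
  induction i with
  | zero => simp [raisingCoeff]
  | succ i ih => simp [raisingCoeff, raisingCoeff_of_lt (Nat.lt_succ_self i), ih, pow_succ]

/-- Iterates `H_{k+1} = (2X - d/dX) H_k`. The free bound `N` lets all rows share one summation
range, as a matrix product requires. -/
lemma hermitePoly_add_eq_sum (k i N : ℕ) (h : i < N) :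
    hermitePoly (k + i)
      = ∑ l ∈ Finset.range N, raisingCoeff i l * derivative^[l] (hermitePoly k) := by
  induction i with
  | zero =>
    obtain ⟨N, rfl⟩ := Nat.exists_eq_succ_of_ne_zero h.ne'
    rw [Finset.sum_range_succ']
    simp [raisingCoeff]
  | succ i ih =>
    obtain ⟨N, rfl⟩ := Nat.exists_eq_succ_of_ne_zero (Nat.ne_zero_of_lt h)
    have ih := ih (by omega)
    rw [← add_assoc, hermitePoly, ih, derivative_sum, Finset.mul_sum]
    simp only [derivative_mul, ← Function.iterate_succ_apply' derivative]
    rw [Finset.sum_add_distrib, Finset.sum_range_succ (fun l => raisingCoeff i l * _) N,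
      raisingCoeff_of_lt (show i < N by omega), Finset.sum_range_succ' _ N,
      Finset.sum_range_succ' _ N, Finset.sum_range_succ' _ N]
    simp only [raisingCoeff, sub_mul, Finset.sum_sub_distrib, mul_assoc]
    ring

/-- The Wronskian of `hermiteCoeff m, …, hermiteCoeff (m + n - 1)`. -/
def hermiteWronskian (m n : ℕ) : ℂ[X] :=
  (Matrix.of fun i j : Fin n => derivative^[i] (hermiteCoeff (m + j))).det

/-- The ratio of `hankelDet` and `hermiteWronskian`. -/
def hankelConst (m n : ℕ) : ℂ := ∏ i ∈ Finset.range n, (-1) ^ i * ((m + i).factorial : ℂ)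

lemma hankelConst_ne_zero (m n : ℕ) : hankelConst m n ≠ 0 :=
  Finset.prod_ne_zero_iff.2 fun i _ => mul_ne_zero (pow_ne_zero _ (by norm_num))
    (by exact_mod_cast (m + i).factorial_ne_zero)

lemma hankelDet_eq_hermiteWronskian (m n : ℕ) :
    hankelDet m n = C (hankelConst m n) * hermiteWronskian m n := by
  have h : (Matrix.of fun i j : Fin n => hermitePoly (m + i + j))
      = (Matrix.of fun i l : Fin n => raisingCoeff i l)
        * Matrix.of fun i j : Fin n => C ((m + j).factorial : ℂ) *
          (Matrix.of fun i j : Fin n => derivative^[i] (hermiteCoeff (m + j))) i j := by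
    ext1 i j
    rw [Matrix.mul_apply, Matrix.of_apply, add_right_comm, hermitePoly_add_eq_sum _ i n i.2,
      Finset.sum_range]
    refine Finset.sum_congr rfl fun l _ => ?_
    simp only [Matrix.of_apply]
    rw [← iterate_derivative_C_mul, C_factorial_mul_hermiteCoeff]
  rw [hankelDet, h, Matrix.det_mul, Matrix.det_mul_row, Matrix.det_of_isLowerTriangular,
    hermiteWronskian, ← mul_assoc, hankelConst, ← Fin.prod_univ_eq_prod_range
      (fun i => (-1) ^ i * ((m + i).factorial : ℂ)), Finset.prod_mul_distrib, C_mul, map_prod,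
      map_prod]
  · simp [raisingCoeff_self]
  · intro i j hij
    exact raisingCoeff_of_lt (by simpa using hij)

/-- Because `h_{k+1}' = 2 h_k`, deleting the first row of the Wronskian only lowers the index and
yields powers of `2`. All five minors in the Desnanot-Jacobi identity are therefore Wronskians
again. -/
lemma hermiteWronskian_desnanot (m n : ℕ) :
    hermiteWronskian (m + 1) (n + 2) * hermiteWronskian (m + 1) n
      = C 2 * (hermiteWronskian (m + 1) (n + 1) ^ 2
        - hermiteWronskian (m + 2) (n + 1) * hermiteWronskian m (n + 1)) := by
  have hj := Matrix.det_mul_det_interior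
    (Matrix.of fun i j : Fin (n + 2) => derivative^[i] (hermiteCoeff (m + 1 + j)))
  have hs : ∀ k p : ℕ, (Matrix.of fun i j : Fin p =>
      C 2 * derivative^[i] (hermiteCoeff (k + j))).det = C 2 ^ p * hermiteWronskian k p := by
    intro k p
    have := Matrix.det_smul (Matrix.of fun i j : Fin p => derivative^[i] (hermiteCoeff (k + j)))
      (C 2 : ℂ[X])
    rw [Fintype.card_fin] at this
    rw [hermiteWronskian, ← this]
    rfl
  simp only [Matrix.submatrix, Matrix.of_apply, Fin.val_castSucc, Fin.val_succ, ← add_assoc,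
    iterate_derivative_succ_hermiteCoeff_succ, add_right_comm m 1] at hj
  have hw : ∀ k p : ℕ, (Matrix.of fun i j : Fin p =>
      derivative^[i] (hermiteCoeff (k + j))).det = hermiteWronskian k p := fun _ _ => rfl
  simp only [fun j : ℕ => add_right_comm m j 1, fun j : ℕ => add_right_comm (m + 1) j 1, hs, hw]
    at hj
  refine mul_left_cancel₀ (pow_ne_zero n (C_ne_zero.2 (two_ne_zero (α := ℂ)))) ?_
  linear_combination hj


lemma hankelConst_succ (m n : ℕ) :
    hankelConst m (n + 1) = hankelConst m n * ((-1) ^ n * ((m + n).factorial : ℂ)) :=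
  Finset.prod_range_succ _ _

lemma hankelConst_mul_hankelConst_add_two (m n : ℕ) :
    hankelConst m (n + 2) * hankelConst m n
      = -((m : ℂ) + n + 1) * hankelConst m (n + 1) ^ 2 := by
  rw [hankelConst_succ m (n + 1), hankelConst_succ m n, ← add_assoc, Nat.factorial_succ]
  push_cast
  ring

lemma add_one_mul_hankelConst_mul (m n : ℕ) :
    ((m : ℂ) + 1) * (hankelConst (m + 2) n * hankelConst m n)
      = ((m : ℂ) + 1 + n) * hankelConst (m + 1) n ^ 2 := by
  induction n with
  | zero => simp [hankelConst]
  | succ n ih =>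
    rw [hankelConst_succ, hankelConst_succ, hankelConst_succ,
      show m + 2 + n = m + n + 1 + 1 by ring, show m + 1 + n = m + n + 1 by ring,
      Nat.factorial_succ (m + n + 1), Nat.factorial_succ (m + n)]
    have h1 : ((-1 : ℂ) ^ n) * (-1) ^ n = 1 := by rw [← mul_pow]; simp
    push_cast
    linear_combination ((m + n + 1 + 1 : ℂ) * (m + n + 1) * ((m + n).factorial : ℂ) ^ 2
      * ((-1 : ℂ) ^ n) ^ 2) * ih

/-- The bilinear relation in the first index for the Hankel determinants. -/
lemma hankelDet_toda_left (m n : ℕ) :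
    C (2 * ((m : ℂ) + 1)) * (hankelDet (m + 2) n * hankelDet m n)
      = hankelDet (m + 1) n * derivative (derivative (hankelDet (m + 1) n))
        - derivative (hankelDet (m + 1) n) ^ 2
        + C (2 * ((m : ℂ) + 1)) * hankelDet (m + 1) n ^ 2 := by
  match n with
  | 0 => simp
  | n + 1 =>
    have h1 := hankelDet_toda (m + 1) n
    have h2 := hermiteWronskian_desnanot m n
    have h3 := congrArg (C : ℂ →+* ℂ[X]) (hankelConst_mul_hankelConst_add_two (m + 1) n)
    have h4 := congrArg (C : ℂ →+* ℂ[X]) (add_one_mul_hankelConst_mul m (n + 1))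
    -- Both Toda relations contain the same expression `D D'' - D'²`. Eliminating it leaves a
    -- relation without derivatives, which is the Desnanot-Jacobi identity up to constants.
    have h5 : hankelDet (m + 1) (n + 2) * hankelDet (m + 1) n
        + C (2 * ((n : ℂ) + 1)) * hankelDet (m + 1) (n + 1) ^ 2
        + C (2 * ((m : ℂ) + 1)) * hankelDet (m + 1) (n + 1) ^ 2
        = C (2 * ((m : ℂ) + 1)) * (hankelDet (m + 2) (n + 1) * hankelDet m (n + 1)) := by
      simp only [hankelDet_eq_hermiteWronskian]
      simp only [map_mul, map_add, map_neg, map_pow, map_one, map_natCast, map_ofNat,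
        Nat.cast_add, Nat.cast_one] at h2 h3 h4 ⊢
      linear_combination (C (hankelConst (m + 1) (n + 2)) * C (hankelConst (m + 1) n)) * h2
        + 2 * (hermiteWronskian (m + 1) (n + 1) ^ 2
          - hermiteWronskian (m + 2) (n + 1) * hermiteWronskian m (n + 1)) * h3
        - 2 * hermiteWronskian (m + 2) (n + 1) * hermiteWronskian m (n + 1) * h4
    linear_combination h1 - h5

/-! ### Generalized Hermite polynomials as Hankel determinants -/

/-- The ratio of the generalized Hermite polynomials and `hankelDet`. -/
def genHermiteConst : ℕ → ℂ
  | 0 => 1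
  | 1 => 1
  | n + 2 => -(genHermiteConst (n + 1) ^ 2 / (2 * ((n : ℂ) + 1) * genHermiteConst n))

lemma genHermiteConst_ne_zero (n : ℕ) : genHermiteConst n ≠ 0 := by
  induction n using Nat.strong_induction_on with
  | _ n ih =>
    match n with
    | 0 => simp [genHermiteConst]
    | 1 => simp [genHermiteConst]
    | n + 2 =>
      rw [genHermiteConst]
      exact neg_ne_zero.2 (div_ne_zero (pow_ne_zero 2 (ih _ (by omega)))
        (mul_ne_zero (mul_ne_zero two_ne_zero (Nat.cast_add_one_ne_zero n)) (ih _ (by omega))))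

lemma div_eq_of_eq_mul {p q r : ℂ[X]} (hq : q ≠ 0) (h : p = q * r) : p / q = r := by
  rw [h, mul_div_cancel_left₀ _ hq]

lemma toda_quotient (m n : ℕ) {F G : ℂ[X]}
    (hF : F = C (genHermiteConst n) * hankelDet m n)
    (hG : G = C (genHermiteConst (n + 1)) * hankelDet m (n + 1)) :
    (-(G * derivative (derivative G)) + derivative G ^ 2 + C (2 * ((n : ℂ) + 1)) * G ^ 2)
        / (C (2 * ((n : ℂ) + 1)) * F)
      = C (genHermiteConst (n + 2)) * hankelDet m (n + 2) := by
  have hn : (2 * ((n : ℂ) + 1)) ≠ 0 := mul_ne_zero two_ne_zero (Nat.cast_add_one_ne_zero n)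
  subst hF hG
  refine div_eq_of_eq_mul (mul_ne_zero (C_ne_zero.2 hn) (mul_ne_zero
    (C_ne_zero.2 (genHermiteConst_ne_zero n)) (hankelDet_ne_zero m n))) ?_
  have h1 : C (2 * ((n : ℂ) + 1)) * C (genHermiteConst n) * C (genHermiteConst (n + 2))
      = -C (genHermiteConst (n + 1)) ^ 2 := by
    rw [← C_mul, ← C_mul, ← C_pow, ← C_neg, genHermiteConst]
    have := genHermiteConst_ne_zero n
    congr 1
    field_simp
  simp only [derivative_C_mul]
  linear_combination (-C (genHermiteConst (n + 1)) ^ 2) * -hankelDet_toda m n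
    - (hankelDet m (n + 2) * hankelDet m n) * h1

/-- The constant depends on `n` only: the recurrence in `m` is homogeneous quadratic, so it
preserves any such factor, while the recurrence in `n` fixes the factor. -/
lemma genHermite_eq_hankelDet (m n : ℕ) :
    genHermite m n = C (genHermiteConst n) * hankelDet m n := by
  induction m using Nat.strong_induction_on generalizing n with
  | _ m ihm =>
    match m with
    | 0 =>
      induction n using Nat.strong_induction_on with
      | _ n ih =>
        match n with
        | 0 => simp [genHermite, genHermiteConst]
        | 1 => simp [genHermite, genHermiteConst, hermitePoly]
        | n + 2 =>
          rw [genHermite]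
          exact toda_quotient 0 n (ih _ (by omega)) (ih _ (by omega))
    | 1 =>
      induction n using Nat.strong_induction_on with
      | _ n ih =>
        match n with
        | 0 => simp [genHermite, genHermiteConst]
        | 1 => simp [genHermite, genHermiteConst, hermitePoly]
        | n + 2 =>
          rw [genHermite]
          exact toda_quotient 1 n (ih _ (by omega)) (ih _ (by omega))
    | m + 2 =>
      rw [genHermite, ihm (m + 1) (by omega), ihm m (by omega)]
      · have hm : (2 * ((m : ℂ) + 1)) ≠ 0 := mul_ne_zero two_ne_zero (Nat.cast_add_one_ne_zero m)
        refine div_eq_of_eq_mul (mul_ne_zero (C_ne_zero.2 hm) (mul_ne_zero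
          (C_ne_zero.2 (genHermiteConst_ne_zero n)) (hankelDet_ne_zero m n))) ?_
        simp only [derivative_C_mul]
        linear_combination (-C (genHermiteConst n) ^ 2) * hankelDet_toda_left m n

/-- Row `i` of the Wronskian is `2 ^ i h_{m+j-i}`, a Toeplitz pattern; reversing the rows makes it
Hankel, with lowest index `m - (n - 1) = c`. -/
lemma hermiteWronskian_eq_hankel {c m n : ℕ} (h : c + n = m + 1) :
    ∃ k : ℂ, k ≠ 0 ∧ hermiteWronskian m n
      = C k * (Matrix.of fun i j : Fin n => hermiteCoeff (c + i + j)).det := by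
  have h1 : (Matrix.of fun i j : Fin n => derivative^[i] (hermiteCoeff (m + j)))
      = Matrix.of fun i j : Fin n => C (2 ^ (i : ℕ)) *
          ((Matrix.of fun i j : Fin n => hermiteCoeff (c + i + j)).submatrix Fin.revPerm id) i j := by
    ext1 i j
    have hi := i.2
    simp only [Matrix.of_apply, Matrix.submatrix_apply, Fin.revPerm_apply, Fin.val_rev, id]
    rw [← iterate_derivative_hermiteCoeff_add]
    congr 2
    omega
  refine ⟨(∏ i : Fin n, 2 ^ (i : ℕ)) * (Equiv.Perm.sign (Fin.revPerm (n := n)) : ℤ), ?_, ?_⟩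
  · refine mul_ne_zero (Finset.prod_ne_zero_iff.2 fun i _ => by simp) ?_
    exact_mod_cast (Equiv.Perm.sign (Fin.revPerm (n := n))).ne_zero
  · rw [hermiteWronskian, h1, Matrix.det_mul_column, Matrix.det_permute, C_mul, map_prod]
    simp [mul_assoc]

lemma genHermite_eq_hankel {c m n : ℕ} (h : c + n = m + 1) :
    ∃ k : ℂ, k ≠ 0 ∧ genHermite m n
      = C k * (Matrix.of fun i j : Fin n => hermiteCoeff (c + i + j)).det := by
  obtain ⟨k, hk, he⟩ := hermiteWronskian_eq_hankel h
  refine ⟨genHermiteConst n * hankelConst m n * k,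
    mul_ne_zero (mul_ne_zero (genHermiteConst_ne_zero n) (hankelConst_ne_zero m n)) hk, ?_⟩
  rw [genHermite_eq_hankelDet, hankelDet_eq_hermiteWronskian, he, C_mul, C_mul]
  ring

/-! ### Orthogonality with respect to a linear functional -/

section Functional

variable {L : ℂ[X] →ₗ[ℂ] ℂ} {n : ℕ} {p q : ℂ[X]}

lemma functional_mul_eq_sum (L : ℂ[X] →ₗ[ℂ] ℂ) (f g : ℂ[X]) {N : ℕ} (hg : g.natDegree < N) :
    L (f * g) = ∑ i ∈ Finset.range N, g.coeff i * L (X ^ i * f) := by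
  conv_lhs => rw [g.as_sum_range' N hg]
  rw [Finset.mul_sum, map_sum]
  refine Finset.sum_congr rfl fun i _ => ?_
  rw [← C_mul_X_pow_eq_monomial, ← smul_eq_mul (a := g.coeff i), ← map_smul, smul_eq_C_mul]
  congr 1
  ring

/-- The pairing `(f, g) ↦ L (f * g)` on polynomials of degree less than `n` is nondegenerate. -/
lemma eq_zero_of_functional_eq_zero (hp : p.Monic) (hpn : p.natDegree = n)
    (hq : q.natDegree < n) (hpL : ∀ k < n, L (X ^ k * p) = 0)
    (hqL : ∀ k, k + 1 < n → L (X ^ k * q) = 0) (hqn : L (X ^ (n - 1) * q) ≠ 0) {f : ℂ[X]}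
    (hf : f.natDegree < n) (hfL : ∀ k < n, L (X ^ k * f) = 0) : f = 0 := by
  by_contra hne
  have hdeg : ∀ j, (X ^ j * f).natDegree = j + f.natDegree := fun j => by
    rw [natDegree_mul (pow_ne_zero _ X_ne_zero) hne, natDegree_X_pow]
  -- Since `L (p X ^ j f) = 0` whenever `X ^ j f` has degree below `n`, and `p` is monic, each
  -- further moment of `f` is a combination of earlier ones.
  have key : ∀ k, k + f.natDegree + 1 ≤ 2 * n → L (X ^ k * f) = 0 := by
    intro k
    induction k using Nat.strong_induction_on with
    | _ k ih =>
      intro hk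
      by_cases hkn : k < n
      · exact hfL k hkn
      obtain ⟨j, rfl⟩ := Nat.exists_eq_add_of_le (not_lt.1 hkn)
      have h1 : L (p * (X ^ j * f)) = 0 := by
        rw [functional_mul_eq_sum L p _ (N := n) (by rw [hdeg]; omega)]
        exact Finset.sum_eq_zero fun i hi => by
          rw [hpL i (Finset.mem_range.1 hi), mul_zero]
      rw [mul_comm, functional_mul_eq_sum L _ p (N := n + 1) (by omega), Finset.sum_range_succ,
        Finset.sum_eq_zero, zero_add] at h1
      · have hc : p.coeff n = 1 := by rw [← hpn]; exact hp
        rwa [hc, one_mul, ← mul_assoc, ← pow_add] at h1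
      · intro i hi
        rw [Finset.mem_range] at hi
        rw [← mul_assoc, ← pow_add, ih (i + j) (by omega) (by omega), mul_zero]
  -- With this shift `X ^ e f` has degree exactly `n - 1`, so pairing with `q` isolates the leading
  -- coefficient of `f`.
  set e := n - 1 - f.natDegree with he
  have h0 : L (X ^ e * f * q) = 0 := by
    rw [functional_mul_eq_sum L _ q hq]
    refine Finset.sum_eq_zero fun i hi => ?_
    rw [Finset.mem_range] at hi
    rw [← mul_assoc, ← pow_add, key (i + e) (by omega), mul_zero]
  obtain ⟨n, rfl⟩ := Nat.exists_eq_succ_of_ne_zero (Nat.ne_zero_of_lt hf)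
  rw [mul_comm, functional_mul_eq_sum L q _ (N := n + 1) (by rw [hdeg]; omega),
    Finset.sum_range_succ, Finset.sum_eq_zero, zero_add] at h0
  · have hc : (X ^ e * f).coeff n = f.leadingCoeff := by
      rw [show n = f.natDegree + e by omega, coeff_X_pow_mul, coeff_natDegree]
    rw [hc] at h0
    exact mul_ne_zero (leadingCoeff_ne_zero.2 hne) hqn h0
  · intro i hi
    rw [Finset.mem_range] at hi
    rw [hqL i (by omega), mul_zero]

/-- The polynomial `(p(0) q(z) - q(0) p(z)) / z`. -/
def crossDivX (p q : ℂ[X]) : ℂ[X] := divX (C (p.coeff 0) * q - C (q.coeff 0) * p)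

lemma X_mul_crossDivX (p q : ℂ[X]) :
    X * crossDivX p q = C (p.coeff 0) * q - C (q.coeff 0) * p := by
  have h := X_mul_divX_add (C (p.coeff 0) * q - C (q.coeff 0) * p)
  have h0 : (C (p.coeff 0) * q - C (q.coeff 0) * p).coeff 0 = 0 := by
    simp [mul_comm]
  rwa [h0, C_0, add_zero] at h

lemma natDegree_crossDivX_lt (hpn : p.natDegree = n) (hq : q.natDegree < n) :
    (crossDivX p q).natDegree < n := by
  rw [crossDivX, natDegree_divX_eq_natDegree_tsub_one]
  have h1 : (C (p.coeff 0) * q - C (q.coeff 0) * p).natDegree ≤ n :=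
    (natDegree_sub_le _ _).trans (max_le ((natDegree_C_mul_le _ _).trans hq.le)
      ((natDegree_C_mul_le _ _).trans hpn.le))
  omega

lemma functional_X_pow_succ_mul_crossDivX (L : ℂ[X] →ₗ[ℂ] ℂ) (p q : ℂ[X]) (k : ℕ) :
    L (X ^ (k + 1) * crossDivX p q)
      = p.coeff 0 * L (X ^ k * q) - q.coeff 0 * L (X ^ k * p) := by
  rw [pow_succ, mul_assoc, X_mul_crossDivX, mul_sub, map_sub, mul_left_comm, mul_left_comm _ _ p,
    ← smul_eq_C_mul, ← smul_eq_C_mul, map_smul, map_smul, smul_eq_mul, smul_eq_mul]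

/-- Expand `L (p t) = 0` for `t = crossDivX p q` in the powers of `p`: only the constant term `p(0)
L t` and the leading term `L (X ^ n t) = p(0) L (X ^ (n - 1) q)` survive. -/
lemma functional_crossDivX (hp : p.Monic) (hpn : p.natDegree = n)
    (hq : q.natDegree < n) (hpL : ∀ k < n, L (X ^ k * p) = 0)
    (hqL : ∀ k, k + 1 < n → L (X ^ k * q) = 0) (h0 : p.coeff 0 ≠ 0) :
    L (crossDivX p q) = -L (X ^ (n - 1) * q) := by
  have h1 : L (p * crossDivX p q) = 0 := by
    rw [functional_mul_eq_sum L p _ (natDegree_crossDivX_lt hpn hq)]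
    exact Finset.sum_eq_zero fun i hi => by rw [hpL i (Finset.mem_range.1 hi), mul_zero]
  obtain ⟨n, rfl⟩ := Nat.exists_eq_succ_of_ne_zero (Nat.ne_zero_of_lt hq)
  have hc : p.coeff (n + 1) = 1 := by rw [← Nat.succ_eq_add_one, ← hpn]; exact hp
  rw [mul_comm, functional_mul_eq_sum L _ p (N := n + 2) (by omega), Finset.sum_range_succ,
    Finset.sum_range_succ', Finset.sum_eq_zero, zero_add, hc,
    functional_X_pow_succ_mul_crossDivX, hpL n (by omega)] at h1
  · refine mul_left_cancel₀ h0 ?_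
    simp only [pow_zero, one_mul, Nat.succ_eq_add_one, Nat.add_sub_cancel] at h1 ⊢
    linear_combination h1
  · intro i hi
    rw [Finset.mem_range] at hi
    rw [functional_X_pow_succ_mul_crossDivX, hqL i (by omega), hpL i (by omega)]
    ring

end Functional

/-- Replacing the first Hankel column by the next one after the last gives the shifted Hankel matrix
up to a cyclic rotation of columns. -/
lemma cramer_hankel_zero (ν : ℕ → ℂ[X]) (n : ℕ) :
    (Matrix.of fun i j : Fin (n + 1) => ν (i + j)).cramer (fun i => -ν (i + (n + 1))) 0
      = (-1) ^ (n + 1) * (Matrix.of fun i j : Fin (n + 1) => ν (i + j + 1)).det := by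
  set M : Matrix (Fin (n + 1)) (Fin (n + 1)) ℂ[X] := Matrix.of fun i j => ν (i + j) with hM
  have h : (Matrix.of fun i j : Fin (n + 1) => ν (i + j + 1))
      = (M.updateCol 0 fun i => ν (i + (n + 1))).submatrix id (finRotate (n + 1)) := by
    ext1 i j
    refine Fin.lastCases ?_ (fun j => ?_) j
    · simp [add_assoc]
    · have : (j.castSucc + 1 : Fin (n + 1)) = j.succ := by simp
      rw [Matrix.submatrix_apply, finRotate_apply, this,
        Matrix.updateCol_ne (Fin.succ_ne_zero j)]
      simp [hM, add_assoc]
  have hneg : (fun i : Fin (n + 1) => -ν (i + (n + 1)))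
      = (-1 : ℂ[X]) • fun i : Fin (n + 1) => ν (i + (n + 1)) := by
    ext1 i; simp
  rw [h, Matrix.det_permute', sign_finRotate, hneg, Matrix.cramer_apply, Matrix.det_updateCol_smul]
  have h1 : ((-1 : ℂ[X]) ^ n) * (-1) ^ n = 1 := by rw [← mul_pow]; simp
  simp only [Nat.add_sub_cancel, Units.val_pow_eq_pow_val, Units.val_neg, Units.val_one,
    Int.cast_pow, Int.cast_neg, Int.cast_one]
  linear_combination (M.updateCol 0 fun i => ν (i + (n + 1))).det * h1

/-- The first-order deformation of `p(0)`, where `p` is the monic orthogonal polynomial. -/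
lemma hankel_deformation {n : ℕ} {p q : ℂ[X]} {μ : ℕ → ℂ[X]} {Λ : ℂ[X] →ₗ[ℂ] ℂ} {ρ y : ℂ}
    (hμ : ∀ j, derivative (μ (j + 1)) = C (2 * ρ) * μ j)
    (hΛ : ∀ j, Λ (X ^ j) = (μ j).eval y)
    (hp : p.Monic) (hpn : p.natDegree = n) (hq : q.natDegree < n)
    (hpL : ∀ k < n, Λ (X ^ (k + 1) * p) = 0) (hqL : ∀ k, k + 1 < n → Λ (X ^ (k + 1) * q) = 0)
    (hqn : Λ (X ^ n * q) ≠ 0) (h0 : p.coeff 0 ≠ 0) :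
    ((Matrix.of fun i j : Fin n => μ (i + j + 1)).det).eval y ≠ 0 ∧
    (-1) ^ n * ((Matrix.of fun i j : Fin n => μ (i + j + 2)).det).eval y
      = ((Matrix.of fun i j : Fin n => μ (i + j + 1)).det).eval y * p.coeff 0 ∧
    (-1) ^ n * (derivative (Matrix.of fun i j : Fin n => μ (i + j + 2)).det).eval y
      = (derivative (Matrix.of fun i j : Fin n => μ (i + j + 1)).det).eval y * p.coeff 0
        + 2 * ρ * Λ p / Λ (X ^ n * q)
          * ((Matrix.of fun i j : Fin n => μ (i + j + 1)).det).eval y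
          * (p.coeff 0 * q.coeff 1 - q.coeff 0 * p.coeff 1) := by
  obtain ⟨n, rfl⟩ := Nat.exists_eq_succ_of_ne_zero (Nat.ne_zero_of_lt hq)
  rw [Nat.succ_eq_add_one] at *
  set M : Matrix (Fin (n + 1)) (Fin (n + 1)) ℂ[X] := Matrix.of fun i j => μ (i + j + 1) with hM
  set D := M.det with hD
  set A : Matrix (Fin (n + 1)) (Fin (n + 1)) ℂ := M.map (eval y) with hA
  -- Orthogonality holds for `L`; the extra moment `Λ p`, one index lower, appears only upon
  -- differentiation.
  let L : ℂ[X] →ₗ[ℂ] ℂ := Λ ∘ₗ LinearMap.mulLeft ℂ X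
  have hL : ∀ f, L f = Λ (X * f) := fun f => rfl
  have hLX : ∀ k f, L (X ^ k * f) = Λ (X ^ (k + 1) * f) := fun k f => by
    rw [hL, pow_succ', mul_assoc]
  have hpL' : ∀ k < n + 1, L (X ^ k * p) = 0 := fun k hk => by rw [hLX, hpL k hk]
  have hqL' : ∀ k, k + 1 < n + 1 → L (X ^ k * q) = 0 := fun k hk => by rw [hLX, hqL k hk]
  have hqn' : L (X ^ n * q) = Λ (X ^ (n + 1) * q) := hLX _ _
  have hpc : p.coeff (n + 1) = 1 := by rw [← hpn]; exact hp
  -- the matrix of the functional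
  have hmul : ∀ f : ℂ[X], f.natDegree < n + 1 → ∀ i : Fin (n + 1),
      A.mulVec (fun j => f.coeff j) i = L (X ^ (i : ℕ) * f) := by
    intro f hf i
    rw [functional_mul_eq_sum L _ f hf, Matrix.mulVec, dotProduct, Finset.sum_range]
    refine Finset.sum_congr rfl fun j _ => ?_
    rw [hL, ← pow_add, ← pow_succ', hΛ, mul_comm]
    simp [hA, hM, add_comm (j : ℕ)]
  have hdetA : A.det = D.eval y := by
    rw [hA, hD, ← coe_evalRingHom, ← RingHom.mapMatrix_apply, ← RingHom.map_det]
  have hD0 : D.eval y ≠ 0 := by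
    rw [← hdetA]
    intro hdet
    obtain ⟨v, hv, hAv⟩ := Matrix.exists_mulVec_eq_zero_iff.2 hdet
    set f : ℂ[X] := ∑ j : Fin (n + 1), C (v j) * X ^ (j : ℕ) with hf
    have hfd : f.natDegree < n + 1 := by
      refine Nat.lt_succ_of_le (natDegree_sum_le_of_forall_le _ _ fun j _ => ?_)
      exact (natDegree_C_mul_X_pow_le _ _).trans (Nat.le_of_lt_succ j.2)
    have hfc : ∀ j : Fin (n + 1), f.coeff j = v j := by
      intro j
      rw [hf, finsetSum_coeff, Finset.sum_eq_single j]
      · simp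
      · intro b _ hb
        rw [coeff_C_mul_X_pow, if_neg fun h => hb (Fin.ext h.symm)]
      · simp
    have hf0 : f = 0 := by
      refine eq_zero_of_functional_eq_zero hp hpn hq hpL' hqL' (by simpa [hqn'] using hqn) hfd
        fun k hk => ?_
      have := hmul f hfd ⟨k, hk⟩
      rw [← this, funext hfc, hAv, Pi.zero_apply]
    exact hv (funext fun j => by rw [← hfc, hf0, coeff_zero, Pi.zero_apply])
  have hinj : ∀ v : Fin (n + 1) → ℂ, A.mulVec v = 0 → v = 0 := fun v hv =>
    Matrix.eq_zero_of_mulVec_eq_zero (by rwa [hdetA]) hv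
  -- A polynomial solution in the variable `y`: at the given point it equals `D` times the
  -- coefficients of `p`, and it can be differentiated without dividing by `D`.
  set U := M.cramer fun i => -μ (i + (n + 1) + 1) with hU
  have hMU : ∀ i : Fin (n + 1), ∑ j : Fin (n + 1), μ (i + j + 1) * U j
      = -(D * μ (i + (n + 1) + 1)) := by
    intro i
    have := congrFun (Matrix.mulVec_cramer M fun i => -μ (i + (n + 1) + 1)) i
    simpa [Matrix.mulVec, dotProduct, hM] using this
  have hU0 : U 0 = (-1) ^ (n + 1) * (Matrix.of fun i j : Fin (n + 1) => μ (i + j + 2)).det :=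
    cramer_hankel_zero (fun j => μ (j + 1)) n
  -- orthogonality of `p` in coordinates
  have hΛp : ∀ k, Λ (X ^ k * p)
      = ∑ j : Fin (n + 1), (μ (k + j)).eval y * p.coeff j + (μ (k + (n + 1))).eval y := by
    intro k
    rw [functional_mul_eq_sum Λ _ p (N := n + 2) (by omega), Finset.sum_range_succ, hpc, one_mul,
      ← pow_add, hΛ, add_comm (n + 1) k, Finset.sum_range]
    congr 1
    refine Finset.sum_congr rfl fun j _ => ?_
    rw [← pow_add, hΛ, add_comm (j : ℕ), mul_comm]
  have hUp : ∀ j, (U j).eval y = D.eval y * p.coeff j := by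
    have := hinj (fun j => (U j).eval y - D.eval y * p.coeff j) ?_
    · exact fun j => sub_eq_zero.1 (congrFun this j)
    ext i
    have h1 := congrArg (eval y) (hMU i)
    have h2 := hΛp (i + 1)
    rw [hpL i i.2] at h2
    simp only [eval_finsetSum, eval_mul, eval_neg] at h1
    simp only [Matrix.mulVec, dotProduct, mul_sub, Finset.sum_sub_distrib, Pi.zero_apply]
    simp only [mul_left_comm _ (eval y D), ← Finset.mul_sum, hA, hM, Matrix.map_apply,
      Matrix.of_apply, h1]
    simp only [add_right_comm _ 1] at h2
    linear_combination (eval y D) * h2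
  set t := crossDivX p q with ht
  have htd : t.natDegree < n + 1 := natDegree_crossDivX_lt hpn hq
  have hU' : ∀ j, (derivative (U j)).eval y = (derivative D).eval y * p.coeff j
      + 2 * ρ * Λ p / Λ (X ^ (n + 1) * q) * D.eval y * t.coeff j := by
    set κ := Λ (X ^ (n + 1) * q) with hκ
    have := hinj (fun j => (derivative (U j)).eval y - (derivative D).eval y * p.coeff j
      - 2 * ρ * Λ p / κ * D.eval y * t.coeff j) ?_
    · intro j
      have h := congrFun this j
      rw [Pi.zero_apply] at h
      linear_combination h
    ext i
    have h1 := congrArg (fun f => eval y (derivative f)) (hMU i)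
    have h2 := hΛp (i + 1)
    rw [hpL i i.2] at h2
    have h3 := hΛp i
    -- The differentiated system has right-hand side proportional to `Λ (X ^ i p)`, nonzero at most
    -- for `i = 0`; the moments `L (X ^ i t)` have the same pattern.
    have h4 : Λ (X ^ (i : ℕ) * p) * κ + Λ p * L (X ^ (i : ℕ) * t) = 0 := by
      refine Fin.cases ?_ (fun i => ?_) i
      · have := functional_crossDivX hp hpn hq hpL' hqL' h0
        simp only [Nat.add_sub_cancel] at this
        simp [ht, this, hqn']
      · have hi := i.2
        rw [ht, Fin.val_succ, functional_X_pow_succ_mul_crossDivX, hqL' i (by omega),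
          hpL' i (by omega), hpL i (by omega)]
        ring
    rw [← hmul t htd] at h4
    simp only [derivative_sum, derivative_mul, hμ, eval_finsetSum, eval_mul, eval_neg, eval_add,
      derivative_neg, eval_C, Finset.sum_add_distrib, hUp] at h1
    simp only [Matrix.mulVec, dotProduct, mul_sub, Finset.sum_sub_distrib, Pi.zero_apply, hA, hM,
      Matrix.map_apply, Matrix.of_apply] at h4 ⊢
    simp only [mul_left_comm _ (eval y (derivative D)),
      mul_left_comm _ (2 * ρ * Λ p / κ * D.eval y), ← Finset.mul_sum] at h4 ⊢
    simp only [add_right_comm _ 1] at h2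
    have h5 : ∑ j : Fin (n + 1), 2 * ρ * eval y (μ (i + j)) * (eval y D * p.coeff j)
        = 2 * ρ * eval y D * ∑ j : Fin (n + 1), eval y (μ (i + j)) * p.coeff j := by
      rw [Finset.mul_sum]
      exact Finset.sum_congr rfl fun j _ => by ring
    rw [h5] at h1
    field_simp
    linear_combination κ * h1 + κ * eval y (derivative D) * h2 + 2 * ρ * eval y D * κ * h3
      - 2 * ρ * eval y D * h4
  refine ⟨hD0, ?_, ?_⟩
  · have := hUp 0
    rw [hU0] at this
    simpa using this
  · have := hU' 0
    rw [hU0] at this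
    have ht0 : t.coeff 0 = p.coeff 0 * q.coeff 1 - q.coeff 0 * p.coeff 1 := by
      simp [ht, crossDivX, coeff_divX]
    rw [← ht0]
    have hd : derivative ((-1 : ℂ[X]) ^ (n + 1)) = 0 := by
      rw [← C_1, ← C_neg, ← C_pow, derivative_C]
    rw [derivative_mul, hd] at this
    simpa using this

/-! ### Cauchy integrals and continuation across the circle -/

open Metric

local notation "κ₀" => (2 * (Real.pi : ℂ) * Complex.I)

lemma closure_compl_unitClosedBall : closure (closedBall (0 : ℂ) 1)ᶜ = (ball (0 : ℂ) 1)ᶜ := by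
  rw [closure_compl, interior_closedBall _ one_ne_zero]

lemma mem_closure_unitBall {s : ℂ} (hs : s ∈ sphere (0 : ℂ) 1) : s ∈ closure (ball (0 : ℂ) 1) := by
  rw [closure_ball _ one_ne_zero]
  exact sphere_subset_closedBall hs

/-- Extension to the closed disk of an analytic function with boundary values. -/
lemma exists_diffContOnCl_unitBall {F g : ℂ → ℂ} (hF : AnalyticOnNhd ℂ F (ball 0 1))
    (hb : ∀ s ∈ sphere (0 : ℂ) 1, Tendsto F (𝓝[ball 0 1] s) (𝓝 (g s))) :
    ∃ f : ℂ → ℂ, DiffContOnCl ℂ f (ball 0 1) ∧ Set.EqOn f F (ball 0 1) ∧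
      Set.EqOn f g (sphere 0 1) := by
  have hball : ∀ z ∈ ball (0 : ℂ) 1, Tendsto F (𝓝[ball 0 1] z) (𝓝 (F z)) := fun z hz =>
    (hF z hz).continuousAt.tendsto.mono_left nhdsWithin_le_nhds
  have heq : Set.EqOn (extendFrom (ball 0 1) F) F (ball 0 1) := fun z hz =>
    extendFrom_eq (subset_closure hz) (hball z hz)
  refine ⟨extendFrom (ball 0 1) F, ⟨hF.differentiableOn.congr heq, ?_⟩, heq, fun s hs =>
    extendFrom_eq (mem_closure_unitBall hs) (hb s hs)⟩
  refine continuousOn_extendFrom subset_rfl fun z hz => ?_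
  rw [closure_ball _ one_ne_zero, ← ball_union_sphere] at hz
  exact hz.elim (fun h => ⟨_, hball z h⟩) fun h => ⟨_, hb z h⟩

lemma circleIntegral_of_interior {F g : ℂ → ℂ} (hF : AnalyticOnNhd ℂ F (ball 0 1))
    (hb : ∀ s ∈ sphere (0 : ℂ) 1, Tendsto F (𝓝[ball 0 1] s) (𝓝 (g s))) :
    (∮ z in C(0, 1), z⁻¹ * g z) = κ₀ * F 0 := by
  obtain ⟨f, hf, hfF, hfg⟩ := exists_diffContOnCl_unitBall hF hb
  have h := Complex.circleIntegral_sub_center_inv_smul_of_differentiable_on_off_countable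
    one_pos Set.countable_empty hf.continuousOn_ball
    (fun z hz => hf.differentiableAt isOpen_ball hz.1)
  rw [hfF (mem_ball_self one_pos)] at h
  rw [← smul_eq_mul, ← h]
  refine circleIntegral.integral_congr zero_le_one fun z hz => ?_
  simp [hfg hz]

/-- The contour is pushed to a large circle of radius `R`, where `F` is uniformly close to `l`. -/
lemma circleIntegral_of_exterior {F g : ℂ → ℂ} {l : ℂ} (hF : AnalyticOnNhd ℂ F (closedBall 0 1)ᶜ)
    (hb : ∀ s ∈ sphere (0 : ℂ) 1, Tendsto F (𝓝[(closedBall 0 1)ᶜ] s) (𝓝 (g s)))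
    (hl : Tendsto F (cobounded ℂ) (𝓝 l)) :
    (∮ z in C(0, 1), z⁻¹ * g z) = κ₀ * l := by
  set f := extendFrom (closedBall (0 : ℂ) 1)ᶜ F with hf
  have hout : ∀ z ∈ (closedBall (0 : ℂ) 1)ᶜ, Tendsto F (𝓝[(closedBall (0 : ℂ) 1)ᶜ] z) (𝓝 (F z)) :=
    fun z hz => (hF z hz).continuousAt.tendsto.mono_left nhdsWithin_le_nhds
  have heq : Set.EqOn f F (closedBall 0 1)ᶜ := fun z hz =>
    extendFrom_eq (subset_closure hz) (hout z hz)
  have hfg : Set.EqOn f g (sphere 0 1) := fun s hs =>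
    extendFrom_eq (by rw [closure_compl_unitClosedBall]; simp_all) (hb s hs)
  have hcont : ContinuousOn f (ball 0 1)ᶜ := by
    rw [hf]
    refine continuousOn_extendFrom closure_compl_unitClosedBall.ge fun z hz => ?_
    by_cases hz1 : z ∈ closedBall (0 : ℂ) 1
    · exact ⟨_, hb z (by rw [← closedBall_sdiff_ball]; exact ⟨hz1, hz⟩)⟩
    · exact ⟨_, hout z hz1⟩
  have hdiff : ∀ z ∈ (closedBall (0 : ℂ) 1)ᶜ, DifferentiableAt ℂ f z := fun z hz =>
    (hF z hz).differentiableAt.congr_of_eventuallyEq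
      (heq.eventuallyEq_of_mem (isClosed_closedBall.isOpen_compl.mem_nhds hz))
  have hzero : (∮ z in C(0, 1), z⁻¹ * (f z - l)) = 0 := by
    rw [← norm_le_zero_iff]
    refine le_of_forall_pos_le_add fun ε hε => ?_
    have hε' : 0 < ε / (2 * Real.pi) := by positivity
    have hev := (Metric.tendsto_nhds.1 hl) _ hε'
    rw [← comap_norm_atTop, eventually_comap] at hev
    obtain ⟨R, hR⟩ := (hev.and (eventually_gt_atTop 1)).exists
    have hR1 : 1 < R := hR.2
    have h := Complex.circleIntegral_sub_center_inv_smul_eq_of_differentiable_on_annulus_off_countable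
      (f := fun z => f z - l) one_pos hR1.le Set.countable_empty
      ((hcont.mono fun z hz => hz.2).sub continuousOn_const)
      (fun z hz => (hdiff z hz.1.2).sub_const l)
    simp only [sub_zero, smul_eq_mul] at h
    rw [← h, zero_add]
    refine (circleIntegral.norm_integral_le_of_norm_le_const (C := R⁻¹ * (ε / (2 * Real.pi)))
      (by linarith) fun z hz => ?_).trans_eq ?_
    · have hzR : ‖z‖ = R := by simpa using hz
      have hz1 : z ∈ (closedBall (0 : ℂ) 1)ᶜ := by simp [hzR, hR1]
      rw [norm_mul, norm_inv, hzR, heq hz1]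
      have := hR.1 z hzR
      rw [dist_eq_norm] at this
      gcongr
    · have := Real.pi_ne_zero
      field_simp
  have hci : ∀ u : ℂ → ℂ, ContinuousOn u (sphere 0 1) →
      CircleIntegrable (fun z => z⁻¹ * u z) 0 1 := fun u hu =>
    ContinuousOn.circleIntegrable zero_le_one ((continuousOn_id.inv₀ fun z hz =>
      ne_zero_of_mem_unit_sphere ⟨z, hz⟩).mul hu)
  have hc : ContinuousOn f (sphere 0 1) := hcont.mono fun z hz => by simp_all
  simp only [mul_sub] at hzero
  rw [circleIntegral.integral_sub (hci _ hc) (hci _ continuousOn_const), sub_eq_zero] at hzero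
  have h1 := circleIntegral.integral_sub_center_inv (0 : ℂ) (R := 1) one_ne_zero
  simp only [sub_zero] at h1
  rw [circleIntegral.integral_congr zero_le_one (g := fun z => z⁻¹ * f z)
    fun z hz => by simp only [hfg hz], hzero]
  simp only [mul_comm _ l]
  rw [circleIntegral.integral_const_mul, h1]

/-- A function that is analytic across the circle and of polynomial growth is a polynomial. -/
lemma exists_polynomial_of_boundary {F g : ℂ → ℂ} {l : ℂ} (n : ℕ)
    (hF : AnalyticOnNhd ℂ F (sphere 0 1)ᶜ)
    (hin : ∀ s ∈ sphere (0 : ℂ) 1, Tendsto F (𝓝[ball 0 1] s) (𝓝 (g s)))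
    (hout : ∀ s ∈ sphere (0 : ℂ) 1, Tendsto F (𝓝[(closedBall 0 1)ᶜ] s) (𝓝 (g s)))
    (hl : Tendsto (fun z => F z * (z ^ n)⁻¹) (cobounded ℂ) (𝓝 l)) :
    ∃ P : ℂ[X], P.natDegree ≤ n ∧ P.coeff n = l ∧ Set.EqOn F (fun z => P.eval z) (ball 0 1) ∧
      Set.EqOn g (fun z => P.eval z) (sphere 0 1) := by
  have hFin : AnalyticOnNhd ℂ F (ball 0 1) := hF.mono fun z hz => by
    simp only [Set.mem_compl_iff, mem_sphere, mem_ball] at *; exact hz.ne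
  have hFout : AnalyticOnNhd ℂ F (closedBall 0 1)ᶜ := hF.mono fun z hz => by
    simp only [Set.mem_compl_iff, mem_sphere, mem_closedBall, not_le] at *; exact hz.ne'
  obtain ⟨f, hf, hfF, hfg⟩ := exists_diffContOnCl_unitBall hFin hin
  have hps := DiffContOnCl.hasFPowerSeriesOnBall (R := 1) hf one_pos
  -- The Taylor coefficients at `0`, written through boundary values. Evaluated from outside, they
  -- vanish for `k > n` and equal `l` for `k = n`.
  set c : ℕ → ℂ := fun k => κ₀⁻¹ * ∮ z in C(0, 1), z⁻¹ * ((z ^ k)⁻¹ * g z) with hc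
  have hcoef : ∀ k l', Tendsto (fun z => (z ^ k)⁻¹ * F z) (cobounded ℂ) (𝓝 l') → c k = l' := by
    intro k l' hk
    rw [hc]
    have hne : κ₀ ≠ 0 := Complex.two_pi_I_ne_zero
    simp only
    rw [circleIntegral_of_exterior (F := fun z => (z ^ k)⁻¹ * F z) ?_ ?_ hk,
      inv_mul_cancel_left₀ hne]
    · intro z hz
      have hz0 : z ≠ 0 := by rintro rfl; simp at hz
      exact ((analyticAt_id.pow k).inv (pow_ne_zero k hz0)).mul (hFout z hz)
    · intro s hs
      have hs0 : s ≠ 0 := ne_zero_of_mem_unit_sphere ⟨s, hs⟩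
      refine Tendsto.mul (Tendsto.mono_left ?_ nhdsWithin_le_nhds) (hout s hs)
      exact ((continuousAt_id.pow k).inv₀ (pow_ne_zero k hs0)).tendsto
  have hcn : c n = l := hcoef n l (by simpa only [mul_comm] using hl)
  have hck : ∀ k, n < k → c k = 0 := by
    intro k hk
    refine hcoef k 0 ?_
    have h1 : Tendsto (fun z : ℂ => (z ^ (k - n))⁻¹) (cobounded ℂ) (𝓝 0) :=
      tendsto_inv₀_cobounded.comp (tendsto_pow_cobounded_cobounded (by omega))
    have h2 := h1.mul hl
    rw [zero_mul] at h2
    refine h2.congr' ?_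
    filter_upwards [eventually_ne_cobounded (0 : ℂ)] with z hz
    have : z ^ k = z ^ (k - n) * z ^ n := by rw [← pow_add]; congr 1; omega
    rw [this, mul_inv]; ring
  set P : ℂ[X] := ∑ k ∈ Finset.range (n + 1), C (c k) * X ^ k with hP
  have hball : Set.EqOn F (fun z => P.eval z) (ball 0 1) := by
    intro z hz
    have hs := hps.hasSum (y := z) (by simpa [← ofReal_norm, ENNReal.ofReal_lt_one] using hz)
    rw [zero_add, hfF hz] at hs
    have hterm : ∀ k, (cauchyPowerSeries f 0 ((1 : NNReal) : ℝ) k fun _ => z) = c k * z ^ k := by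
      intro k
      rw [cauchyPowerSeries_apply, hc]
      simp only [smul_eq_mul]
      have hcomm : ∀ a b d : ℂ, a * b * d = a * (d * b) := fun a b d => by ring
      rw [hcomm κ₀⁻¹, ← circleIntegral.integral_const_mul (z ^ k), NNReal.coe_one]
      congr 1
      refine circleIntegral.integral_congr zero_le_one fun w hw => ?_
      simp only [hfg hw, sub_zero, div_pow]
      ring
    simp only [hterm] at hs
    have hs' := hasSum_sum_of_ne_finset_zero (L := .unconditional ℕ) (f := fun k => c k * z ^ k)
      (s := Finset.range (n + 1)) fun k hk => by
        rw [hck k (by simpa using hk), zero_mul]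
    rw [hs.unique hs', hP]
    simp [eval_finsetSum]
  refine ⟨P, natDegree_sum_le_of_forall_le _ _ fun k hk => (natDegree_C_mul_X_pow_le _ _).trans
    (Nat.le_of_lt_succ (Finset.mem_range.1 hk)), ?_, hball, fun s hs => ?_⟩
  · rw [hP, finsetSum_coeff, ← hcn]
    simp [coeff_X_pow]
  · have : (𝓝[ball (0 : ℂ) 1] s).NeBot :=
      mem_closure_iff_nhdsWithin_neBot.1 (mem_closure_unitBall hs)
    refine tendsto_nhds_unique (hin s hs) ?_
    refine ((P.continuous.tendsto s).mono_left nhdsWithin_le_nhds).congr' ?_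
    filter_upwards [self_mem_nhdsWithin] with z hz using (hball hz).symm

/-! ### Moments of the weight -/

/-- `exp (2 ρ y / s - ρ ^ 2 / s ^ 2)`. -/
def expWeight (ρ y s : ℂ) : ℂ := Complex.exp (2 * ρ * y * s⁻¹ - ρ ^ 2 * (s⁻¹) ^ 2)

lemma hasDerivAt_expWeight (ρ y : ℂ) {s : ℂ} (hs : s ≠ 0) :
    HasDerivAt (expWeight ρ y)
      (expWeight ρ y s * (-(2 * ρ * y * (s⁻¹) ^ 2) + 2 * ρ ^ 2 * (s⁻¹) ^ 3)) s := by
  have h := (((hasDerivAt_inv hs).const_mul (2 * ρ * y)).sub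
    (((hasDerivAt_inv hs).pow 2).const_mul (ρ ^ 2))).cexp
  refine h.congr_deriv ?_
  simp only [expWeight, Pi.sub_apply, Pi.pow_apply]
  congr 1
  rw [← inv_pow]
  norm_num
  ring

lemma analyticOnNhd_expWeight (ρ y : ℂ) : AnalyticOnNhd ℂ (expWeight ρ y) {0}ᶜ :=
  DifferentiableOn.analyticOnNhd
    (fun _ hs => (hasDerivAt_expWeight ρ y hs).differentiableAt.differentiableWithinAt)
    isOpen_compl_singleton

lemma tendsto_expWeight_cobounded (ρ y : ℂ) :
    Tendsto (expWeight ρ y) (cobounded ℂ) (𝓝 1) := by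
  have h : Continuous fun u : ℂ => Complex.exp (2 * ρ * y * u - ρ ^ 2 * u ^ 2) := by fun_prop
  have h1 : Tendsto (expWeight ρ y) (cobounded ℂ) _ :=
    (h.tendsto 0).comp (tendsto_inv₀_cobounded (α := ℂ))
  simpa using h1

lemma circleIntegrable_inv_mul {u : ℂ → ℂ} (hu : ContinuousOn u (sphere 0 1)) :
    CircleIntegrable (fun z => z⁻¹ * u z) 0 1 :=
  ContinuousOn.circleIntegrable zero_le_one
    ((continuousOn_id.inv₀ fun z hz => ne_zero_of_mem_unit_sphere ⟨z, hz⟩).mul hu)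

lemma continuousOn_expWeight (ρ y : ℂ) : ContinuousOn (expWeight ρ y) (sphere 0 1) :=
  (analyticOnNhd_expWeight ρ y).continuousOn.mono fun z hz =>
    ne_zero_of_mem_unit_sphere ⟨z, hz⟩

/-- The integral of a polynomial against `s ^ (c - 1) * expWeight ρ y s` on the unit circle. -/
def weightFunctional (c : ℕ) (ρ y : ℂ) : ℂ[X] →ₗ[ℂ] ℂ where
  toFun f := κ₀⁻¹ * ∮ s in C(0, 1), s⁻¹ * (s ^ c * f.eval s * expWeight ρ y s)
  map_add' f g := by
    rw [← mul_add, ← circleIntegral.integral_add]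
    · congr 2
      ext s
      rw [eval_add]; ring
    all_goals
      exact circleIntegrable_inv_mul (((continuous_id.pow c).mul
        (Polynomial.continuous _)).continuousOn.mul (continuousOn_expWeight ρ y))
  map_smul' a f := by
    rw [RingHom.id_apply, smul_eq_mul, mul_left_comm, ← circleIntegral.integral_const_mul a]
    congr 2
    ext s
    rw [eval_smul, smul_eq_mul]; ring

lemma circleIntegral_expWeight_step (ρ y : ℂ) (k : ℤ) :
    (∮ s in C(0, 1), (((k : ℂ) * s ^ (k - 1)) * expWeight ρ y s
      + s ^ k * (expWeight ρ y s * (-(2 * ρ * y * (s⁻¹) ^ 2) + 2 * ρ ^ 2 * (s⁻¹) ^ 3)))) = 0 := by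
  refine circleIntegral.integral_eq_zero_of_hasDerivWithinAt
    (f := fun s => s ^ k * expWeight ρ y s) zero_le_one fun s hs => ?_
  have hs0 : s ≠ 0 := ne_zero_of_mem_unit_sphere ⟨s, hs⟩
  exact ((hasDerivAt_zpow k s (Or.inl hs0)).mul (hasDerivAt_expWeight ρ y hs0)).hasDerivWithinAt

/-- The moments `∮ s ^ (k - 1) * expWeight ρ y s`. -/
def expMoment (ρ y : ℂ) (k : ℤ) : ℂ := ∮ s in C(0, 1), s⁻¹ * (s ^ k * expWeight ρ y s)

/-- The integral of the derivative of `s ^ (k + 2) * expWeight ρ y s` over the closed circle is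
zero. -/
lemma expMoment_recurrence (ρ y : ℂ) (k : ℤ) :
    ((k : ℂ) + 2) * expMoment ρ y (k + 2)
      = 2 * ρ * y * expMoment ρ y (k + 1) - 2 * ρ ^ 2 * expMoment ρ y k := by
  have h := circleIntegral_expWeight_step ρ y (k + 2)
  have hi : ∀ (a : ℂ) (j : ℤ),
      CircleIntegrable (fun s => a * (s⁻¹ * (s ^ j * expWeight ρ y s))) 0 1 := fun a j =>
    (circleIntegrable_inv_mul ((continuousOn_id.zpow₀ j fun z hz =>
      Or.inl (ne_zero_of_mem_unit_sphere (⟨z, hz⟩ : sphere (0 : ℂ) 1))).mul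
        (continuousOn_expWeight ρ y))).const_fun_smul
  have hsub := circleIntegral.integral_sub (hi (k + 2) (k + 2)) (hi (2 * ρ * y) (k + 1))
  have hadd := circleIntegral.integral_add
    ((hi (k + 2) (k + 2)).sub (hi (2 * ρ * y) (k + 1))) (hi (2 * ρ ^ 2) k)
  simp only [Pi.sub_apply] at hadd
  rw [circleIntegral.integral_congr zero_le_one (g := fun s =>
    (((k : ℂ) + 2) * (s⁻¹ * (s ^ (k + 2) * expWeight ρ y s))
      - 2 * ρ * y * (s⁻¹ * (s ^ (k + 1) * expWeight ρ y s)))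
      + 2 * ρ ^ 2 * (s⁻¹ * (s ^ k * expWeight ρ y s))) ?_,
    hadd, hsub, circleIntegral.integral_const_mul,
    circleIntegral.integral_const_mul, circleIntegral.integral_const_mul] at h
  · simp only [expMoment]
    linear_combination h
  · intro s hs
    have hs0 : s ≠ 0 := ne_zero_of_mem_unit_sphere ⟨s, hs⟩
    have e1 : s ^ (k + 2 - 1) = s ^ k * s := by
      rw [show k + 2 - 1 = k + 1 by ring, zpow_add_one₀ hs0]
    have e2 : s ^ (k + 2) = s ^ k * s ^ 2 := by
      rw [zpow_add₀ hs0]; norm_cast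
    simp only [e1, e2, zpow_add_one₀ hs0]
    push_cast
    field_simp
    ring

lemma expMoment_of_tendsto (ρ y : ℂ) (k : ℤ) {l : ℂ}
    (h : Tendsto (fun s => s ^ k * expWeight ρ y s) (cobounded ℂ) (𝓝 l)) :
    expMoment ρ y k = κ₀ * l := by
  have hA : ∀ s : ℂ, s ≠ 0 → AnalyticAt ℂ (fun s => s ^ k * expWeight ρ y s) s := fun s hs =>
    (analyticAt_id.zpow hs).mul (analyticOnNhd_expWeight ρ y s hs)
  refine circleIntegral_of_exterior (F := fun s => s ^ k * expWeight ρ y s) (fun s hs => hA s ?_)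
    (fun s hs => ?_) h
  · rintro rfl; simp at hs
  · exact (hA s (ne_zero_of_mem_unit_sphere ⟨s, hs⟩)).continuousAt.tendsto.mono_left
      nhdsWithin_le_nhds

lemma hermitePoly_add_two (k : ℕ) :
    hermitePoly (k + 2) = C 2 * X * hermitePoly (k + 1) - C (2 * ((k : ℂ) + 1)) * hermitePoly k := by
  rw [hermitePoly, derivative_hermitePoly_succ]

lemma hermiteCoeff_add_two (k : ℕ) :
    C ((k : ℂ) + 2) * hermiteCoeff (k + 2)
      = C 2 * X * hermiteCoeff (k + 1) - C 2 * hermiteCoeff k := by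
  have h1 : ((k : ℂ) + 1) ≠ 0 := Nat.cast_add_one_ne_zero k
  have h2 : ((k : ℂ) + 2) ≠ 0 := by exact_mod_cast (Nat.succ_ne_zero (k + 1))
  have h3 : (k.factorial : ℂ) ≠ 0 := by exact_mod_cast k.factorial_ne_zero
  have e2 : hermiteCoeff (k + 2)
      = C ((((k : ℂ) + 2) * (k + 1) * k.factorial)⁻¹) * hermitePoly (k + 2) := by
    rw [hermiteCoeff, Nat.factorial_succ, Nat.factorial_succ]
    congr 3; push_cast; ring
  have e1 : hermiteCoeff (k + 1) = C ((((k : ℂ) + 1) * k.factorial)⁻¹) * hermitePoly (k + 1) := by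
    rw [hermiteCoeff, Nat.factorial_succ]; push_cast; rfl
  have c1 : C ((k : ℂ) + 2) * C ((((k : ℂ) + 2) * (k + 1) * k.factorial)⁻¹)
      = C ((((k : ℂ) + 1) * k.factorial)⁻¹) := by
    rw [← C_mul]; congr 1; field_simp
  have c2 : C ((((k : ℂ) + 1) * k.factorial)⁻¹) * C (2 * ((k : ℂ) + 1))
      = C 2 * C ((k.factorial : ℂ)⁻¹) := by
    rw [← C_mul, ← C_mul]; congr 1; field_simp
  rw [e2, e1, hermitePoly_add_two, hermiteCoeff]
  linear_combination (C 2 * X * hermitePoly (k + 1) - C (2 * ((k : ℂ) + 1)) * hermitePoly k) * c1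
    - hermitePoly k * c2

lemma hermiteCoeff_zero : hermiteCoeff 0 = 1 := by simp [hermiteCoeff, hermitePoly]

lemma hermiteCoeff_one : hermiteCoeff 1 = C 2 * X := by simp [hermiteCoeff, hermitePoly]

lemma expMoment_natCast (ρ y : ℂ) (k : ℕ) :
    expMoment ρ y k = κ₀ * (ρ ^ k * (hermiteCoeff k).eval y) := by
  have h0 : expMoment ρ y 0 = κ₀ * 1 :=
    expMoment_of_tendsto ρ y 0 (by simpa using tendsto_expWeight_cobounded ρ y)
  -- Starting the three-term recurrence at index `-1`, where the moment is zero, also yields the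
  -- moment of index `1`.
  have hm : expMoment ρ y (-1) = κ₀ * 0 :=
    expMoment_of_tendsto ρ y (-1)
      (by simpa using (tendsto_inv₀_cobounded (α := ℂ)).mul (tendsto_expWeight_cobounded ρ y))
  induction k using Nat.strong_induction_on with
  | _ k ih =>
    match k with
    | 0 => simpa [hermiteCoeff_zero] using h0
    | 1 =>
      have h := expMoment_recurrence ρ y (-1)
      norm_num at h
      rw [hm, h0] at h
      rw [hermiteCoeff_one]
      simp only [Nat.cast_one, pow_one, eval_mul, eval_C, eval_X]
      linear_combination h
    | k + 2 =>
      have h := expMoment_recurrence ρ y k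
      have h1 := ih (k + 1) (by omega)
      rw [Nat.cast_add, Nat.cast_one] at h1
      rw [h1, ih k (by omega)] at h
      have h2 := congrArg (eval y) (hermiteCoeff_add_two k)
      simp only [eval_mul, eval_C, eval_sub, eval_X] at h2
      have h3 : ((k : ℂ) + 2) ≠ 0 := by exact_mod_cast (Nat.succ_ne_zero (k + 1))
      refine mul_left_cancel₀ h3 ?_
      push_cast at h ⊢
      linear_combination h - κ₀ * ρ ^ (k + 2) * h2

lemma weightFunctional_X_pow (c : ℕ) (ρ y : ℂ) (k : ℕ) :
    weightFunctional c ρ y (X ^ k) = (C (ρ ^ (c + k)) * hermiteCoeff (c + k)).eval y := by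
  have h := expMoment_natCast ρ y (c + k)
  have hne : κ₀ ≠ 0 := Complex.two_pi_I_ne_zero
  change κ₀⁻¹ * _ = _
  rw [eval_mul, eval_C, inv_mul_eq_iff_eq_mul₀ hne, ← h, expMoment]
  congr 1
  ext s
  rw [eval_pow, eval_X, zpow_natCast, pow_add]

/-- The coefficient of the logarithm is the integer `m - n`, so the branch cut disappears; `n √(m/n)
= √n √m` produces the scaled variable. -/
lemma mul_exp_neg_theta {m n : ℕ} (hn : 1 ≤ n) (hmn : n ≤ m) (x : ℂ) {s : ℂ} (hs : s ≠ 0) :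
    Complex.exp (-(n : ℂ) * theta s x ((m : ℝ) / (n : ℝ)))
      = s ^ (m - n) * expWeight ((Real.sqrt n : ℝ) : ℂ) (((Real.sqrt m : ℝ) : ℂ) * x) s := by
  obtain ⟨d, rfl⟩ := Nat.exists_eq_add_of_le hmn
  have hnR : (n : ℝ) ≠ 0 := by positivity
  have hnC : (n : ℂ) ≠ 0 := by exact_mod_cast hnR
  have h1 : (((Real.sqrt n : ℝ) : ℂ)) ^ 2 = n := by
    rw [← Complex.ofReal_pow, Real.sq_sqrt (Nat.cast_nonneg n), Complex.ofReal_natCast]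
  have h2 : (n : ℂ) * ((Real.sqrt (((n + d : ℕ) : ℝ) / n) : ℝ) : ℂ)
      = ((Real.sqrt n : ℝ) : ℂ) * ((Real.sqrt ((n + d : ℕ) : ℝ) : ℝ) : ℂ) := by
    rw [← Complex.ofReal_natCast, ← Complex.ofReal_mul, ← Complex.ofReal_mul]
    congr 1
    rw [Real.sqrt_div (Nat.cast_nonneg _)]
    have h3 : Real.sqrt n ≠ 0 := (Real.sqrt_pos.2 (by positivity)).ne'
    have h4 : Real.sqrt n * Real.sqrt n = n := Real.mul_self_sqrt (Nat.cast_nonneg n)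
    rw [mul_div_assoc', div_eq_iff h3, mul_right_comm, h4]
  have h5 : -(n : ℂ) * theta s x (((n + d : ℕ) : ℝ) / (n : ℝ))
      = d * Complex.log s + (2 * ((Real.sqrt n : ℝ) : ℂ) *
        (((Real.sqrt ((n + d : ℕ) : ℝ) : ℝ) : ℂ) * x) * s⁻¹
          - ((Real.sqrt n : ℝ) : ℂ) ^ 2 * (s⁻¹) ^ 2) := by
    have h6 : (n : ℂ) * (1 - (((((n + d : ℕ) : ℝ) / (n : ℝ)) : ℝ) : ℂ)) = -d := by
      push_cast; field_simp; ring
    rw [theta, h1, one_div, div_eq_mul_inv (_ * x) s, ← inv_pow]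
    linear_combination -Complex.log s * h6 + 2 * x * s⁻¹ * h2
  rw [h5, Complex.exp_add, Nat.add_sub_cancel_left, expWeight, Complex.exp_nat_mul,
    Complex.exp_log hs]

/-! ### Consequences of the Riemann-Hilbert problem -/

section Solution

variable {m n : ℕ} {x : ℂ} {N : ℂ → Matrix (Fin 2) (Fin 2) ℂ}

lemma IsSolution.tendsto_zero_col (hN : IsSolution m n x N) (i : Fin 2) :
    Tendsto (fun z => N z i 0 * (z ^ n)⁻¹) (cobounded ℂ) (𝓝 ((1 : Matrix (Fin 2) (Fin 2) ℂ) i 0)) := by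
  have h := (hN.normalization i 0).trans_tendsto tendsto_inv₀_cobounded
  rw [← tendsto_sub_nhds_zero_iff]
  simpa [Matrix.mul_apply, Fin.sum_univ_two] using h

lemma IsSolution.tendsto_one_col (hN : IsSolution m n x N) (i : Fin 2) :
    Tendsto (fun z => N z i 1 * z ^ n) (cobounded ℂ) (𝓝 ((1 : Matrix (Fin 2) (Fin 2) ℂ) i 1)) := by
  have h := (hN.normalization i 1).trans_tendsto tendsto_inv₀_cobounded
  rw [← tendsto_sub_nhds_zero_iff]
  simpa [Matrix.mul_apply, Fin.sum_univ_two] using h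

/-- The first column of a solution is polynomial inside the circle, and the second column
encodes its moments with respect to the weight. -/
lemma IsSolution.exists_polynomial (hn : 1 ≤ n) (hmn : n ≤ m) (hN : IsSolution m n x N)
    (i : Fin 2) :
    ∃ P : ℂ[X], P.natDegree ≤ n ∧ P.coeff n = (1 : Matrix (Fin 2) (Fin 2) ℂ) i 0 ∧
      Set.EqOn (fun z => N z i 0) (fun z => P.eval z) (ball 0 1) ∧
      ∀ (k : ℕ) (l : ℂ), Tendsto (fun z => z ^ k * N z i 1) (cobounded ℂ) (𝓝 l) →
        weightFunctional (m - n) ((Real.sqrt n : ℝ) : ℂ) (((Real.sqrt m : ℝ) : ℂ) * x) (X ^ k * P)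
          = κ₀ * (l - 0 ^ k * N 0 i 1) := by
  obtain ⟨Np, Nm, ⟨K, α, hα, -, hhol⟩, hlim, hjump⟩ := hN.boundary
  have hin : ∀ j, AnalyticOnNhd ℂ (fun z => N z i j) (ball 0 1) := fun j =>
    (hN.analytic i j).mono fun z hz => by
      simp only [Set.mem_compl_iff, mem_sphere, mem_ball] at *; exact hz.ne
  have hout : ∀ j, AnalyticOnNhd ℂ (fun z => N z i j) (closedBall 0 1)ᶜ := fun j =>
    (hN.analytic i j).mono fun z hz => by
      simp only [Set.mem_compl_iff, mem_sphere, mem_closedBall, not_le] at *; exact hz.ne'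
  have hj0 : ∀ s ∈ sphere (0 : ℂ) 1, Np s i 0 = Nm s i 0 := fun s hs => by
    rw [hjump s hs]; simp [jump, Matrix.mul_apply, Fin.sum_univ_two]
  have hj1 : ∀ s ∈ sphere (0 : ℂ) 1, Np s i 1 - Nm s i 1 = κ₀⁻¹ * (Nm s i 0 *
      (s ^ (m - n) * expWeight ((Real.sqrt n : ℝ) : ℂ) (((Real.sqrt m : ℝ) : ℂ) * x) s)) := by
    intro s hs
    rw [hjump s hs, ← mul_exp_neg_theta hn hmn x (ne_zero_of_mem_unit_sphere ⟨s, hs⟩)]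
    simp only [jump, Matrix.mul_apply, Fin.sum_univ_two, Matrix.of_apply, Matrix.cons_val', Matrix.cons_val_zero,
      Matrix.cons_val_one, Matrix.cons_val_fin_one, mul_one, one_div]
    ring
  obtain ⟨P, hPd, hPc, hPN, hPs⟩ := exists_polynomial_of_boundary (g := fun s => Nm s i 0) n
    (hN.analytic i 0) (fun s hs => (hlim s hs i 0).2)
    (fun s hs => by rw [← hj0 s hs]; exact (hlim s hs i 0).1) (hN.tendsto_zero_col i)
  refine ⟨P, hPd, hPc, hPN, fun k l hl => ?_⟩
  have hpow : ∀ (A : Set ℂ) (s : ℂ), Tendsto (fun z : ℂ => z ^ k) (𝓝[A] s) (𝓝 (s ^ k)) :=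
    fun A s => ((continuous_pow k).tendsto s).mono_left nhdsWithin_le_nhds
  -- The exterior integral sees the limit at infinity and the interior one the value at `0`; the
  -- jump makes their difference a moment of `P`.
  have h1 := circleIntegral_of_exterior (F := fun z => z ^ k * N z i 1)
    (g := fun z => z ^ k * Np z i 1)
    (fun z hz => (analyticAt_id.pow k).mul (hout 1 z hz))
    (fun s hs => (hpow _ s).mul (hlim s hs i 1).1) hl
  have h2 := circleIntegral_of_interior (F := fun z => z ^ k * N z i 1)
    (g := fun z => z ^ k * Nm z i 1)
    (fun z hz => (analyticAt_id.pow k).mul (hin 1 z hz))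
    (fun s hs => (hpow _ s).mul (hlim s hs i 1).2)
  have hcont : ∀ G : ℂ → Matrix (Fin 2) (Fin 2) ℂ,
      HolderOnWith K α (fun z => G z i 1) (sphere 0 1) →
      CircleIntegrable (fun z => z⁻¹ * (z ^ k * G z i 1)) 0 1 := fun G hG =>
    circleIntegrable_inv_mul ((continuous_pow k).continuousOn.mul (hG.continuousOn hα))
  rw [mul_sub, ← h1, ← h2, ← circleIntegral.integral_sub (hcont _ (hhol i 1).1)
    (hcont _ (hhol i 1).2)]
  change κ₀⁻¹ * _ = _
  rw [← circleIntegral.integral_const_mul]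
  refine circleIntegral.integral_congr zero_le_one fun s hs => ?_
  have h3 := hj1 s hs
  have h4 : Nm s i 0 = P.eval s := hPs hs
  rw [h4] at h3
  simp only [eval_mul, eval_pow, eval_X]
  linear_combination -s⁻¹ * s ^ k * h3

lemma IsSolution.tendsto_pow_mul (hN : IsSolution m n x N) (i : Fin 2) {k : ℕ} (hk : k < n) :
    Tendsto (fun z => z ^ k * N z i 1) (cobounded ℂ) (𝓝 0) := by
  have h1 : Tendsto (fun z : ℂ => (z ^ (n - k))⁻¹) (cobounded ℂ) (𝓝 0) :=
    tendsto_inv₀_cobounded.comp (tendsto_pow_cobounded_cobounded (by omega))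
  have h2 := h1.mul (hN.tendsto_one_col i)
  rw [zero_mul] at h2
  refine h2.congr' ?_
  filter_upwards [eventually_ne_cobounded (0 : ℂ)] with z hz
  have h3 : z ^ n = z ^ (n - k) * z ^ k := by rw [← pow_add]; congr 1; omega
  have h4 : z ^ (n - k) ≠ 0 := pow_ne_zero _ hz
  rw [h3]
  field_simp

end Solution

lemma coeff_one_eq_of_isBigO {F : ℂ → ℂ} {P : ℂ[X]} {a b : ℂ}
    (hF : F =ᶠ[𝓝 0] fun z => P.eval z)
    (h : (fun z => F z - (a + b * z)) =O[𝓝 0] fun z : ℂ => z ^ 2) :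
    P.coeff 0 = a ∧ P.coeff 1 = b := by
  -- The `O(z²)` bound holds at `z = 0` itself, where it forces equality.
  have h0 : F 0 = a := by
    obtain ⟨c, hc⟩ := h.bound
    have := hc.self_of_nhds
    simp only [mul_zero, add_zero, ne_eq, OfNat.ofNat_ne_zero, not_false_eq_true, zero_pow,
      norm_zero] at this
    exact sub_eq_zero.1 (norm_le_zero_iff.1 this)
  have hd : HasDerivAt F b 0 := by
    rw [hasDerivAt_iff_isLittleO]
    have h2 : (fun z : ℂ => z ^ 2) =o[𝓝 0] fun z : ℂ => z - 0 := by
      simpa using isLittleO_pow_id (𝕜 := ℂ) (n := 2) (by norm_num)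
    refine (h.trans_isLittleO h2).congr_left fun z => ?_
    rw [h0, sub_zero, smul_eq_mul]; ring
  have hd' := (P.hasDerivAt 0).congr_of_eventuallyEq hF
  refine ⟨?_, ?_⟩
  · rw [coeff_zero_eq_eval_zero, ← h0, hF.self_of_nhds]
  · rw [hd.unique hd', ← coeff_zero_eq_eval_zero, coeff_derivative]
    simp

lemma logDeriv_eval_div {F G : ℂ[X]} {y : ℂ} (hF : F.eval y ≠ 0) (hG : G.eval y ≠ 0) :
    logDeriv (fun u => F.eval u / G.eval u) y
      = (derivative F).eval y / F.eval y - (derivative G).eval y / G.eval y := by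
  rw [logDeriv_div y hF hG F.differentiableAt G.differentiableAt, logDeriv_apply, logDeriv_apply,
    F.deriv, G.deriv]

/-- The scaling of the argument turns the Hankel determinant by a power of `ρ`. -/
lemma det_scaled_hankel (ρ : ℂ) (c d n : ℕ) :
    (Matrix.of fun i j : Fin n =>
        C (ρ ^ (c + (i + j + d))) * hermiteCoeff (c + (i + j + d))).det
      = C (ρ ^ (n * (c + d) + 2 * ∑ i : Fin n, (i : ℕ))) *
        (Matrix.of fun i j : Fin n => hermiteCoeff (c + d + i + j)).det := by
  have h : (Matrix.of fun i j : Fin n =>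
        C (ρ ^ (c + (i + j + d))) * hermiteCoeff (c + (i + j + d)))
      = Matrix.of fun i j : Fin n => C (ρ ^ (c + d + i)) *
          (Matrix.of fun i j : Fin n => C (ρ ^ (j : ℕ)) *
            (Matrix.of fun i j : Fin n => hermiteCoeff (c + d + i + j)) i j) i j := by
    ext1 i j
    simp only [Matrix.of_apply]
    have e : c + ((i : ℕ) + j + d) = c + d + i + j := by ring
    rw [e, ← mul_assoc, ← C_mul, ← pow_add]
  rw [h, Matrix.det_mul_column, Matrix.det_mul_row, ← mul_assoc, ← map_prod, ← map_prod, ← C_mul,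
    Finset.prod_pow_eq_pow_sum, Finset.prod_pow_eq_pow_sum, ← pow_add, Finset.sum_add_distrib]
  congr 3
  simp
  ring

end PainleveIV

end

/-! ### The main theorem -/

theorem lemma2 (m n : ℕ) (hn : 1 ≤ n) (hmn : n ≤ m) (x : ℂ)
    (N : ℂ → Matrix (Fin 2) (Fin 2) ℂ) (hN : PainleveIV.IsSolution m n x N)
    (N₀ N₁ : Matrix (Fin 2) (Fin 2) ℂ)
    (hexp : ∀ i j, (fun z : ℂ => N z i j - (N₀ i j + N₁ i j * z)) =O[𝓝 0] (fun z : ℂ => z ^ 2))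
    (h₀ : N₀ 0 0 ≠ 0) :
    (PainleveIV.genHermite m n).eval (((Real.sqrt m : ℝ) : ℂ) * x) ≠ 0 ∧
    (PainleveIV.genHermite (m + 1) n).eval (((Real.sqrt m : ℝ) : ℂ) * x) ≠ 0 ∧
    1 / ((Real.sqrt n : ℝ) : ℂ) * PainleveIV.wI m n (((Real.sqrt m : ℝ) : ℂ) * x)
      = (N₀ 0 0 * N₀ 1 1 + N₀ 0 1 * N₀ 1 0 - 1) * (N₁ 0 0 / N₀ 0 0)
        - 2 * N₀ 0 1 * N₁ 1 0 := by
  obtain ⟨p, hpd, hpc, hpN, hpw⟩ := hN.exists_polynomial hn hmn 0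
  obtain ⟨q, hqd, hqc, hqN, hqw⟩ := hN.exists_polynomial hn hmn 1
  set y : ℂ := ((Real.sqrt m : ℝ) : ℂ) * x with hy
  set ρ : ℂ := ((Real.sqrt n : ℝ) : ℂ) with hρ
  have hρ0 : ρ ≠ 0 := by
    rw [hρ]; exact_mod_cast (Real.sqrt_pos.2 (by exact_mod_cast hn)).ne'
  set κ : ℂ := 2 * (Real.pi : ℂ) * Complex.I with hκ
  have hκ0 : κ ≠ 0 := Complex.two_pi_I_ne_zero
  set Λ := PainleveIV.weightFunctional (m - n) ρ y with hΛ
  have hball : Metric.ball (0 : ℂ) 1 ∈ 𝓝 (0 : ℂ) := Metric.ball_mem_nhds 0 one_pos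
  obtain ⟨hp0, hp1⟩ := PainleveIV.coeff_one_eq_of_isBigO (hpN.eventuallyEq_of_mem hball) (hexp 0 0)
  obtain ⟨hq0, hq1⟩ := PainleveIV.coeff_one_eq_of_isBigO (hqN.eventuallyEq_of_mem hball) (hexp 1 0)
  have hval : ∀ i, N 0 i 1 = N₀ i 1 := by
    intro i
    obtain ⟨c, hc⟩ := (hexp i 1).bound
    have := hc.self_of_nhds
    simp only [mul_zero, add_zero, ne_eq, OfNat.ofNat_ne_zero, not_false_eq_true, zero_pow,
      norm_zero] at this
    exact sub_eq_zero.1 (norm_le_zero_iff.1 this)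
  simp only [Matrix.one_apply, one_ne_zero, if_true, if_false] at hpc hqc
  have hpn : p.natDegree = n :=
    le_antisymm hpd (le_natDegree_of_ne_zero (by rw [hpc]; exact one_ne_zero))
  have hpm : p.Monic := by rw [Monic, leadingCoeff, hpn, hpc]
  have hqn : q.natDegree < n := by
    refine lt_of_le_of_ne hqd fun h => ?_
    have hq : q = 0 := by rw [← leadingCoeff_eq_zero, leadingCoeff, h, hqc]
    rw [hq, natDegree_zero] at h
    omega
  have hlast : ∀ i, Tendsto (fun z => z ^ n * N z i 1) (cobounded ℂ)
      (𝓝 ((1 : Matrix (Fin 2) (Fin 2) ℂ) i 1)) := fun i => by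
    simpa only [mul_comm] using hN.tendsto_one_col i
  have hpL : ∀ k < n, Λ (X ^ (k + 1) * p) = 0 := by
    intro k hk
    -- The borderline power `n` still gives zero, because the limit there is the off-diagonal entry
    -- of the identity.
    rcases Nat.lt_or_eq_of_le (Nat.succ_le_of_lt hk) with h | h
    · rw [hpw (k + 1) 0 (hN.tendsto_pow_mul 0 h)]; simp
    · have h' : k + 1 = n := h
      rw [h', hpw n _ (hlast 0)]
      simp [show n ≠ 0 by omega]
  have hqL : ∀ k, k + 1 < n → Λ (X ^ (k + 1) * q) = 0 := fun k hk => by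
    rw [hqw (k + 1) 0 (hN.tendsto_pow_mul 1 hk)]; simp
  have hqκ : Λ (X ^ n * q) = κ := by
    rw [hqw n _ (hlast 1)]
    simp [show n ≠ 0 by omega]
  have hΛp : Λ p = -κ * N₀ 0 1 := by
    have := hpw 0 0 (hN.tendsto_pow_mul 0 (by omega))
    rw [pow_zero, one_mul] at this
    rw [this, hval]; ring
  have hΛq : Λ q = -κ * N₀ 1 1 := by
    have := hqw 0 0 (hN.tendsto_pow_mul 1 (by omega))
    rw [pow_zero, one_mul] at this
    rw [this, hval]; ring
  -- the determinant of the solution at the origin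
  have hdet : N₀ 0 0 * N₀ 1 1 - N₀ 0 1 * N₀ 1 0 = 1 := by
    -- The moment `Λ (X * crossDivX p q)` equals `-κ`, and it also equals `p(0) Λ q - q(0) Λ p = -κ
    -- det N₀`.
    have h := PainleveIV.functional_crossDivX (L := Λ ∘ₗ LinearMap.mulLeft ℂ X) hpm hpn hqn
      (fun k hk => by
        rw [← hpL k hk, pow_succ', mul_assoc]; rfl)
      (fun k hk => by
        rw [← hqL k hk, pow_succ', mul_assoc]; rfl) (by rwa [hp0])
    have e1 : (Λ ∘ₗ LinearMap.mulLeft ℂ X) (X ^ (n - 1) * q) = κ := by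
      rw [← hqκ, LinearMap.comp_apply, LinearMap.mulLeft_apply, ← mul_assoc, ← pow_succ']
      congr 3; omega
    have e2 := PainleveIV.functional_X_pow_succ_mul_crossDivX Λ p q 0
    simp only [zero_add, pow_one, pow_zero, one_mul] at e2
    rw [e1, LinearMap.comp_apply, LinearMap.mulLeft_apply, e2, hp0, hq0, hΛp, hΛq] at h
    refine mul_left_cancel₀ hκ0 ?_
    linear_combination -h
  have hμ : ∀ j, derivative (C (ρ ^ (m - n + (j + 1))) * PainleveIV.hermiteCoeff (m - n + (j + 1)))
      = C (2 * ρ) * (C (ρ ^ (m - n + j)) * PainleveIV.hermiteCoeff (m - n + j)) := by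
    intro j
    rw [derivative_C_mul, ← add_assoc, PainleveIV.derivative_hermiteCoeff_succ, pow_succ, C_mul,
      C_mul]
    ring
  obtain ⟨hD, hE, hE'⟩ := PainleveIV.hankel_deformation
    (μ := fun j => C (ρ ^ (m - n + j)) * PainleveIV.hermiteCoeff (m - n + j)) hμ
    (PainleveIV.weightFunctional_X_pow (m - n) ρ y) hpm hpn hqn hpL hqL
    (by rw [hqκ]; exact hκ0) (by rwa [hp0])
  obtain ⟨k₁, hk₁, hH₁⟩ := PainleveIV.genHermite_eq_hankel (c := m - n + 1) (m := m) (n := n)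
    (by omega)
  obtain ⟨k₂, hk₂, hH₂⟩ := PainleveIV.genHermite_eq_hankel (c := m - n + 2) (m := m + 1) (n := n)
    (by omega)
  -- The powers of `ρ` in the moments leave the determinants as constants in `y`, which logarithmic
  -- derivatives do not see.
  simp only [PainleveIV.det_scaled_hankel] at hD hE hE'
  rw [hqκ, hΛp, hp0, hp1, hq0, hq1] at hE'
  rw [hp0] at hE
  simp only [derivative_C_mul, eval_mul, eval_C] at hD hE hE'
  set A := (Matrix.of fun i j : Fin n => PainleveIV.hermiteCoeff (m - n + 1 + i + j)).det
  set B := (Matrix.of fun i j : Fin n => PainleveIV.hermiteCoeff (m - n + 2 + i + j)).det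
  set a := ρ ^ (n * (m - n + 1) + 2 * ∑ i : Fin n, (i : ℕ))
  set b := ρ ^ (n * (m - n + 2) + 2 * ∑ i : Fin n, (i : ℕ)) with hb
  have hA0 : A.eval y ≠ 0 := right_ne_zero_of_mul hD
  have hB0 : B.eval y ≠ 0 := fun h => by
    rw [h, mul_zero, mul_zero] at hE
    exact mul_ne_zero hD h₀ hE.symm
  have hF0 : (PainleveIV.genHermite m n).eval y ≠ 0 := by
    rw [hH₁, eval_mul, eval_C]; exact mul_ne_zero hk₁ hA0
  have hG0 : (PainleveIV.genHermite (m + 1) n).eval y ≠ 0 := by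
    rw [hH₂, eval_mul, eval_C]; exact mul_ne_zero hk₂ hB0
  refine ⟨hF0, hG0, ?_⟩
  rw [PainleveIV.wI, PainleveIV.logDeriv_eval_div hG0 hF0, hH₁, hH₂]
  simp only [derivative_C_mul, eval_mul, eval_C]
  rw [mul_div_mul_left _ _ hk₁, mul_div_mul_left _ _ hk₂]
  have hsb : (-1 : ℂ) ^ n * b ≠ 0 :=
    mul_ne_zero (pow_ne_zero _ (by norm_num)) (pow_ne_zero _ hρ0)
  have ha : a ≠ 0 := left_ne_zero_of_mul hD
  have hB : B.eval y = a * A.eval y * N₀ 0 0 / ((-1) ^ n * b) := by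
    rw [eq_div_iff hsb]; linear_combination hE
  have hB' : (derivative B).eval y = (a * (derivative A).eval y * N₀ 0 0
      - 2 * ρ * N₀ 0 1 * (a * A.eval y) * (N₀ 0 0 * N₁ 1 0 - N₀ 1 0 * N₁ 0 0))
        / ((-1) ^ n * b) := by
    rw [eq_div_iff hsb]
    have : 2 * ρ * (-κ * N₀ 0 1) / κ = -(2 * ρ * N₀ 0 1) := by field_simp
    rw [this] at hE'
    linear_combination hE'
  rw [hB, hB', div_div_div_cancel_right₀ hsb]
  have hrhs : N₀ 0 0 * N₀ 1 1 + N₀ 0 1 * N₀ 1 0 - 1 = 2 * (N₀ 0 1 * N₀ 1 0) := by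
    linear_combination hdet
  rw [hrhs]
  field_simp
  ring
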